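/- Let $\Gamma$ be a finite group with set of conjugacy classes $\Gamma_*$, let $c^0=\{1\}$, and let $\Gamma_n=\Gamma^n\rtimes S_n$ be the wreath product, $(g,\sigma)(h,\tau)=(g\,\sigma(h),\sigma\tau)$. For a cycle $(i_1\,i_2\cdots i_k)$ of $\sigma$ (fixed points included), the cycle-product of $x=(g,\sigma)$ is the conjugacy class of $g_{i_k}\cdots g_{i_2}g_{i_1}$. The type of $x$ is the partition-valued function $\rho$ on $\Gamma_*$ for which $\rho(c)$ consists of the lengths of the cycles with cycle-product in $c$; the modified type of $x$ is obtained from it by lowering every part of $\rho(c^0)$ by one and dropping the zeros. For a partition-valued function $\lambda$ on $\Gamma_*$ put $\|\lambda\|=\sum_c|\lambda(c)|$, and let $\|x\|=\|\lambda\|$ if $x$ has modified type $\lambda$. Let $K_\lambda(n)$ be the sum of all elements of $\Gamma_n$ of modified type $\lambda$ in the class algebra $R_{\mathbb Z}(\Gamma_n)=Z(\mathbb Z[\Gamma_n])$, which is filtered by giving $K_\lambda(n)$ degree $\|\lambda\|$. Let $\mathcal G_\Gamma(n)$ be the associated graded ring; the symbol of $K_\lambda(n)$ in degree $\|\lambda\|$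 is again denoted by $K_\lambda(n)$. Let $\mathcal G_\Gamma$ be the Farahat--Higman ring, that is, the ring with $\mathbb Z$-basis $(K_\lambda)_\lambda$ and multiplication $$K_\lambda K_\mu=\sum_{\|\nu\|=\|\lambda\|+\|\mu\|}a_{\lambda\mu}^{\nu}K_\nu ,$$ where $a_{\lambda\mu}^\nu$ is the coefficient in the product $K_\lambda(n)K_\mu(n)\in R_{\mathbb Z}(\Gamma_n)$ of any element of modified type $\nu$, for any $n$ for which $\Gamma_n$ has such an element. (This ring exists, with $a_{\lambda\mu}^\nu$ independent of $n$; it is realised as the subring of $\prod_n\mathcal G_\Gamma(n)$ generated by the families $K_\lambda=(K_\lambda(n))_n$.) It is graded by $\deg K_\lambda=\|\lambda\|$. Write $\mathcal G(n)$ and $\mathcal G$ for these rings when $\Gamma$ is trivial, so that $\Gamma_n=S_n$. Let $\mathcal I_\Gamma(n)\subset\mathcal G_\Gamma(n)$ and $\mathcal I_\Gamma\subset\mathcal G_\Gamma$ be the $\mathbb Z$-spans of those $K_\lambda(n)$, respectively $K_\lambda$, for which $\lambda(c)\neq\emptyset$ for some $c\neq c^0$. For a partition $p$ denote also by $p$ the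 partition-valued function with value $p$ at $c^0$ and $\emptyset$ at all other classes. Then: 1. For every $n\ge 0$, $\mathcal I_\Gamma(n)$ is a graded ideal of $\mathcal G_\Gamma(n)$, and there is exactly one ring isomorphism $\mathcal G_\Gamma(n)/\mathcal I_\Gamma(n)\to\mathcal G(n)$ that sends the class of $K_p(n)$ to $K_p(n)$ for every partition $p$. 2. $\mathcal I_\Gamma$ is a graded ideal of $\mathcal G_\Gamma$, and there is exactly one ring isomorphism $\mathcal G_\Gamma/\mathcal I_\Gamma\to\mathcal G$ that sends the class of $K_p$ to $K_p$ for every partition $p$. -/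

import Mathlib

open scoped DirectSum

namespace FarahatHigman

/-- The wreath product `Γₙ = Γⁿ ⋊ Sₙ`, where `(σ g) k = g (σ⁻¹ k)` and
`(g, σ) (h, τ) = (g · σ h, σ τ)`. -/
abbrev Wreath (Γ : Type*) [Group Γ] (n : ℕ) : Type _ :=
  (Fin n → Γ) ⋊[(mulAutArrow : Equiv.Perm (Fin n) →* MulAut (Fin n → Γ))] Equiv.Perm (Fin n)

/-- A partition: a finite multiset of positive integers. -/
abbrev IntPartition : Type := {m : Multiset ℕ // 0 ∉ m}

/-- IntPartition-valued functions on the set of conjugacy classes of `Γ`. -/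
abbrev PartFun (Γ : Type*) [Group Γ] : Type _ := ConjClasses Γ → IntPartition

/-- The conjugacy class `c⁰` of the identity. -/
abbrev idClass (Γ : Type*) [Group Γ] : ConjClasses Γ := ConjClasses.mk 1

/-- The degree `‖ρ‖ = ∑_c |ρ(c)|`. -/
noncomputable def degree {Γ : Type*} [Group Γ] (ρ : PartFun Γ) : ℕ :=
  ∑ᶠ c : ConjClasses Γ, (ρ c).1.sum

/-- The cycle of `σ` through `i`, as a set of letters (`{i}` if `i` is fixed). -/
noncomputable def cycleThrough {n : ℕ} (σ : Equiv.Perm (Fin n)) (i : Fin n) : Finset (Fin n) := by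
  classical exact Finset.univ.filter fun j => σ.SameCycle i j

/-- All cycles of `σ`, cycles of length one included. -/
noncomputable def cycles {n : ℕ} (σ : Equiv.Perm (Fin n)) : Finset (Finset (Fin n)) := by
  classical exact Finset.univ.image (cycleThrough σ)

/-- The cycle-product `g_{i_k} ⋯ g_{i_2} g_{i_1}` of `x = (g, σ)` along the cycle
`(i_1 i_2 … i_k)` of `σ`, written so that it starts at `i_1 = i`. -/
noncomputable def cycleProd {Γ : Type*} [Group Γ] {n : ℕ} (x : Wreath Γ n) (i : Fin n) : Γ :=
  ((List.range (Function.minimalPeriod x.right i)).reverse.map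
    fun k => x.left ((x.right ^ k) i)).prod

/-- The cycles of `x` whose cycle-product lies in `c`. -/
noncomputable def cyclesIn {Γ : Type*} [Group Γ] {n : ℕ} (x : Wreath Γ n) (c : ConjClasses Γ) :
    Finset (Finset (Fin n)) := by
  classical exact (cycles x.right).filter fun C => ∃ i ∈ C, ConjClasses.mk (cycleProd x i) = c

theorem mem_cycleThrough {n : ℕ} {σ : Equiv.Perm (Fin n)} {i j : Fin n} :
    j ∈ cycleThrough σ i ↔ σ.SameCycle i j := by
  simp [cycleThrough]

theorem mem_cycles {n : ℕ} {σ : Equiv.Perm (Fin n)} {C : Finset (Fin n)} :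
    C ∈ cycles σ ↔ ∃ i, cycleThrough σ i = C := by
  simp [cycles]

theorem mem_cyclesIn {Γ : Type*} [Group Γ] {n : ℕ} {x : Wreath Γ n} {c : ConjClasses Γ}
    {C : Finset (Fin n)} : C ∈ cyclesIn x c ↔
      C ∈ cycles x.right ∧ ∃ i ∈ C, ConjClasses.mk (cycleProd x i) = c := by
  simp [cyclesIn]

/-- The type of `x`: `ρ(c)` consists of the lengths of the cycles with cycle-product in `c`. -/
noncomputable def cycleType {Γ : Type*} [Group Γ] {n : ℕ} (x : Wreath Γ n) : PartFun Γ :=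
  fun c => ⟨(cyclesIn x c).val.map Finset.card, by
    intro h
    obtain ⟨C, hC, h0⟩ := Multiset.mem_map.1 h
    obtain ⟨i, hi, -⟩ := (mem_cyclesIn.1 hC).2
    exact Finset.card_ne_zero_of_mem hi h0⟩

open scoped Classical in
/-- Lowering every part of `ρ(c⁰)` by one (and dropping the zeros). -/
noncomputable def lower {Γ : Type*} [Group Γ] (ρ : PartFun Γ) : PartFun Γ := fun c =>
  if c = idClass Γ then
    ⟨((ρ c).1.map fun r => r - 1).filter fun r => r ≠ 0, by simp⟩
  else
    ρ c

/-- The modified type of `x`. -/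
noncomputable def modifiedType {Γ : Type*} [Group Γ] {n : ℕ} (x : Wreath Γ n) : PartFun Γ :=
  lower (cycleType x)

/-- The degree `‖x‖` of an element of `Γₙ`: the degree of its modified type. -/
noncomputable def elemDegree {Γ : Type*} [Group Γ] {n : ℕ} (x : Wreath Γ n) : ℕ :=
  degree (modifiedType x)

section Cycles

variable {Γ : Type*} [Group Γ] {n : ℕ}

theorem left_mul (x y : Wreath Γ n) (k : Fin n) :
    (x * y).left k = x.left k * y.left (x.right⁻¹ k) := rfl

theorem right_pow (x : Wreath Γ n) (m : ℕ) : (x ^ m).right = x.right ^ m :=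
  map_pow (SemidirectProduct.rightHom) x m

theorem prod_eq (x : Wreath Γ n) (i : Fin n) (m : ℕ) :
    ((List.range m).reverse.map fun k => x.left ((x.right ^ k) i)).prod =
      (x ^ m).left ((x.right ^ m) (x.right⁻¹ i)) := by
  induction m with
  | zero => simp
  | succ m ih =>
    have h1 : (x.right ^ (m + 1)) (x.right⁻¹ i) = (x.right ^ m) i := by
      rw [pow_succ]; simp
    have h2 : x.right⁻¹ ((x.right ^ m) i) = (x.right ^ m) (x.right⁻¹ i) := by
      have := (Commute.refl x.right).inv_left.pow_right m
      exact congrArg (fun f : Equiv.Perm (Fin n) => f i) this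
    rw [List.range_succ, List.reverse_append, List.reverse_singleton, List.singleton_append,
      List.map_cons, List.prod_cons, ih, h1, pow_succ', left_mul, h2]

/-- The cycle-product, read off from a power of `x`. -/
noncomputable def loopLabel (x : Wreath Γ n) (i : Fin n) : Γ :=
  (x ^ Function.minimalPeriod x.right i).left i

theorem pow_period (σ : Equiv.Perm (Fin n)) (i : Fin n) :
    (σ ^ Function.minimalPeriod σ i) i = i := by
  rw [← Equiv.Perm.iterate_eq_pow]
  exact Function.iterate_minimalPeriod

theorem period_conj (σ τ : Equiv.Perm (Fin n)) (i : Fin n) :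
    Function.minimalPeriod (τ * σ * τ⁻¹) (τ i) = Function.minimalPeriod σ i := by
  apply Function.minimalPeriod_eq_minimalPeriod_iff.2
  intro m
  simp only [Function.IsPeriodicPt, Function.IsFixedPt, Equiv.Perm.iterate_eq_pow, conj_pow]
  simp

theorem loopLabel_conj (z x : Wreath Γ n) (i : Fin n) :
    loopLabel (z * x * z⁻¹) (z.right i) = z.left (z.right i) * loopLabel x i *
      (z.left (z.right i))⁻¹ := by
  have hp : Function.minimalPeriod (z * x * z⁻¹).right (z.right i) =
      Function.minimalPeriod x.right i := period_conj _ _ _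
  unfold loopLabel
  rw [hp]
  set m := Function.minimalPeriod x.right i with hm
  have hm' : (x ^ m).right i = i := by rw [right_pow]; exact pow_period _ _
  have h : (z * x * z⁻¹) ^ m * z = z * x ^ m := by rw [conj_pow]; group
  have h1 := congrArg (fun y : Wreath Γ n => y.left (z.right i)) h
  have h2 : ((z * x * z⁻¹) ^ m).right⁻¹ (z.right i) = z.right i := by
    rw [Equiv.Perm.inv_eq_iff_eq]
    rw [conj_pow]
    simp [hm']
  simp only [left_mul, h2] at h1
  rw [eq_mul_inv_iff_mul_eq, h1]
  simp

theorem loopLabel_apply (x : Wreath Γ n) (i : Fin n) :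
    IsConj (loopLabel x (x.right i)) (loopLabel x i) := by
  have h := loopLabel_conj x x i
  rw [mul_inv_cancel_right] at h
  rw [h]
  exact (isConj_iff.2 ⟨_, rfl⟩ : IsConj (loopLabel x i) _).symm

theorem mk_loopLabel_eq {x : Wreath Γ n} {i j : Fin n} (h : x.right.SameCycle i j) :
    ConjClasses.mk (loopLabel x i) = ConjClasses.mk (loopLabel x j) := by
  obtain ⟨m, -, -, rfl⟩ := h.exists_pow_eq
  induction m with
  | zero => rfl
  | succ m ih =>
    rw [ih ⟨m, by simp⟩, pow_succ', Equiv.Perm.mul_apply]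
    exact (ConjClasses.mk_eq_mk_iff_isConj.2 (loopLabel_apply _ _)).symm

theorem mk_cycleProd (x : Wreath Γ n) (i : Fin n) :
    ConjClasses.mk (cycleProd x i) = ConjClasses.mk (loopLabel x i) := by
  have hp : Function.minimalPeriod x.right (x.right⁻¹ i) = Function.minimalPeriod x.right i := by
    have := period_conj x.right x.right (x.right⁻¹ i)
    rw [mul_inv_cancel_right] at this
    simpa using this.symm
  have h : cycleProd x i = loopLabel x (x.right⁻¹ i) := by
    unfold cycleProd loopLabel
    rw [prod_eq, hp]
    have h1 := pow_period x.right (x.right⁻¹ i)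
    rw [hp] at h1
    rw [h1]
  rw [h]
  exact mk_loopLabel_eq ⟨1, by simp⟩

theorem cycleThrough_eq_iff {σ : Equiv.Perm (Fin n)} {i j : Fin n} :
    cycleThrough σ i = cycleThrough σ j ↔ σ.SameCycle i j := by
  constructor
  · intro h
    have : j ∈ cycleThrough σ j := mem_cycleThrough.2 (Equiv.Perm.SameCycle.refl _ _)
    rw [← h] at this
    exact mem_cycleThrough.1 this
  · intro h
    ext k
    simp only [mem_cycleThrough]
    exact ⟨fun h' => h.symm.trans h', fun h' => h.trans h'⟩

theorem self_mem_cycleThrough (σ : Equiv.Perm (Fin n)) (i : Fin n) : i ∈ cycleThrough σ i :=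
  mem_cycleThrough.2 (Equiv.Perm.SameCycle.refl _ _)

theorem cycleThrough_mem_cyclesIn {x : Wreath Γ n} {c : ConjClasses Γ} {i : Fin n} :
    cycleThrough x.right i ∈ cyclesIn x c ↔ ConjClasses.mk (loopLabel x i) = c := by
  rw [mem_cyclesIn]
  constructor
  · rintro ⟨-, j, hj, rfl⟩
    rw [mk_cycleProd]
    exact mk_loopLabel_eq (mem_cycleThrough.1 hj)
  · rintro rfl
    exact ⟨mem_cycles.2 ⟨i, rfl⟩, i, self_mem_cycleThrough _ _, mk_cycleProd x i⟩

theorem cycleThrough_conj (σ τ : Equiv.Perm (Fin n)) (i : Fin n) :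
    cycleThrough (τ * σ * τ⁻¹) (τ i) = (cycleThrough σ i).map τ.toEmbedding := by
  ext k
  rw [mem_cycleThrough, Equiv.Perm.sameCycle_conj]
  rw [Finset.mem_map_equiv, mem_cycleThrough, show τ⁻¹ (τ i) = i from τ.symm_apply_apply i]
  rfl

theorem cycleType_conj (z x : Wreath Γ n) : cycleType (z * x * z⁻¹) = cycleType x := by
  classical
  funext c
  apply Subtype.ext
  have h : cyclesIn (z * x * z⁻¹) c =
      (cyclesIn x c).image fun C => C.map z.right.toEmbedding := by
    ext C
    rw [Finset.mem_image]
    have key : ∀ i, cycleThrough (z * x * z⁻¹).right (z.right i) ∈ cyclesIn (z * x * z⁻¹) c ↔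
        cycleThrough x.right i ∈ cyclesIn x c := by
      intro i
      rw [cycleThrough_mem_cyclesIn, cycleThrough_mem_cyclesIn, loopLabel_conj]
      rw [show ConjClasses.mk (z.left (z.right i) * loopLabel x i * (z.left (z.right i))⁻¹) =
        ConjClasses.mk (loopLabel x i) from
        (ConjClasses.mk_eq_mk_iff_isConj.2 (isConj_iff.2 ⟨_, rfl⟩)).symm]
    constructor
    · intro hC
      obtain ⟨j, rfl⟩ := mem_cycles.1 (mem_cyclesIn.1 hC).1
      obtain ⟨i, rfl⟩ := z.right.surjective j
      exact ⟨_, (key i).1 hC, (cycleThrough_conj _ _ _).symm⟩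
    · rintro ⟨D, hD, rfl⟩
      obtain ⟨i, rfl⟩ := mem_cycles.1 (mem_cyclesIn.1 hD).1
      have := (key i).2 hD
      rwa [show cycleThrough (z * x * z⁻¹).right (z.right i) = _ from
        cycleThrough_conj x.right z.right i] at this
  show (cyclesIn (z * x * z⁻¹) c).val.map Finset.card = (cyclesIn x c).val.map Finset.card
  rw [h, Finset.image_val_of_injOn ((Finset.map_injective _).injOn), Multiset.map_map]
  simp

theorem modifiedType_conj (z x : Wreath Γ n) : modifiedType (z * x * z⁻¹) = modifiedType x := by
  unfold modifiedType
  rw [cycleType_conj]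


/-- The number of cycles with trivial cycle-product. -/
noncomputable def flat (x : Wreath Γ n) : ℕ := (cyclesIn x (idClass Γ)).card

theorem sum_card_cycles (σ : Equiv.Perm (Fin n)) : ∑ C ∈ cycles σ, C.card = n := by
  classical
  have hd : Set.PairwiseDisjoint (cycles σ : Set (Finset (Fin n))) id := by
    intro C hC D hD hne
    obtain ⟨i, rfl⟩ := mem_cycles.1 hC
    obtain ⟨j, rfl⟩ := mem_cycles.1 hD
    refine Finset.disjoint_left.2 fun k hk hk' => hne ?_
    exact cycleThrough_eq_iff.2 ((mem_cycleThrough.1 hk).trans (mem_cycleThrough.1 hk').symm)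
  have h := Finset.card_biUnion (s := cycles σ) (t := id) hd
  rw [show ∑ C ∈ cycles σ, C.card = ∑ C ∈ cycles σ, (id C).card from rfl, ← h]
  rw [show (cycles σ).biUnion id = Finset.univ from ?_]
  · simp
  · ext k
    simp only [Finset.mem_biUnion, Finset.mem_univ, iff_true]
    exact ⟨_, mem_cycles.2 ⟨k, rfl⟩, self_mem_cycleThrough _ _⟩

theorem sum_filter_ne_zero (m : Multiset ℕ) : (m.filter fun r => r ≠ 0).sum = m.sum := by
  induction m using Multiset.induction with
  | empty => simp
  | cons a m ih => by_cases h : a = 0 <;> simp_all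

theorem norm_add_flat [Finite Γ] (x : Wreath Γ n) : elemDegree x + flat x = n := by
  classical
  have : Fintype (ConjClasses Γ) := Fintype.ofFinite _
  have hpos : ∀ c, ∀ C ∈ cyclesIn x c, 1 ≤ C.card := by
    intro c C hC
    obtain ⟨i, hi, -⟩ := (mem_cyclesIn.1 hC).2
    exact Finset.card_pos.2 ⟨i, hi⟩
  have h1 : ∀ c, (modifiedType x c).1.sum + (if c = idClass Γ then flat x else 0) =
      ∑ C ∈ cyclesIn x c, C.card := by
    intro c
    unfold modifiedType lower
    by_cases hc : c = idClass Γ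
    · simp only [if_pos hc, sum_filter_ne_zero]
      subst hc
      rw [flat, Finset.card_eq_sum_ones]
      show (((cyclesIn x _).val.map Finset.card).map fun r => r - 1).sum + _ = _
      rw [Multiset.map_map]
      show (∑ C ∈ cyclesIn x (idClass Γ), (C.card - 1)) + _ = _
      rw [← Finset.sum_add_distrib]
      exact Finset.sum_congr rfl fun C hC => Nat.sub_add_cancel (hpos _ C hC)
    · simp only [if_neg hc, add_zero]
      rfl
  have h2 : elemDegree x + flat x = ∑ c, ∑ C ∈ cyclesIn x c, C.card := by
    rw [elemDegree, degree, finsum_eq_sum_of_fintype, ← Finset.sum_congr rfl fun c _ => h1 c,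
      Finset.sum_add_distrib]
    simp
  rw [h2, ← Finset.sum_biUnion]
  · rw [show Finset.univ.biUnion (cyclesIn x) = cycles x.right from ?_, sum_card_cycles]
    ext C
    simp only [Finset.mem_biUnion, Finset.mem_univ, true_and]
    constructor
    · rintro ⟨c, hc⟩
      exact (mem_cyclesIn.1 hc).1
    · intro hC
      obtain ⟨i, rfl⟩ := mem_cycles.1 hC
      exact ⟨_, cycleThrough_mem_cyclesIn.2 rfl⟩
  · intro c _ d _ hne
    refine Finset.disjoint_left.2 fun C hC hD => hne ?_
    obtain ⟨i, rfl⟩ := mem_cycles.1 (mem_cyclesIn.1 hC).1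
    rw [cycleThrough_mem_cyclesIn] at hC hD
    rw [← hC, ← hD]

theorem mem_flat {x : Wreath Γ n} {i : Fin n} :
    cycleThrough x.right i ∈ cyclesIn x (idClass Γ) ↔ loopLabel x i = 1 := by
  rw [cycleThrough_mem_cyclesIn]
  exact ConjClasses.mk_eq_mk_iff_isConj.trans (by rw [isConj_comm, isConj_one_right])

/-- `φ` trivialises `x` on the invariant set `C`. -/
def Potential (x : Wreath Γ n) (C : Set (Fin n)) (φ : Fin n → Γ) : Prop :=
  ∀ k ∈ C, x.right k ∈ C ∧ φ (x.right k) = x.left (x.right k) * φ k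

theorem Potential.pow {x : Wreath Γ n} {C : Set (Fin n)} {φ : Fin n → Γ} (h : Potential x C φ)
    {k : Fin n} (hk : k ∈ C) (m : ℕ) :
    (x.right ^ m) k ∈ C ∧ φ ((x.right ^ m) k) = (x ^ m).left ((x.right ^ m) k) * φ k := by
  induction m with
  | zero => simpa using hk
  | succ m ih =>
    have := h _ ih.1
    rw [pow_succ', Equiv.Perm.mul_apply]
    refine ⟨this.1, ?_⟩
    rw [this.2, ih.2, pow_succ', left_mul, ← mul_assoc]
    simp

theorem Potential.loopLabel_eq {x : Wreath Γ n} {C : Set (Fin n)} {φ : Fin n → Γ}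
    (h : Potential x C φ) {k : Fin n} (hk : k ∈ C) : loopLabel x k = 1 := by
  have := (h.pow hk (Function.minimalPeriod x.right k)).2
  rw [pow_period] at this
  exact (right_eq_mul.1 this)

theorem exists_potential {x : Wreath Γ n} {i : Fin n} (h : loopLabel x i = 1) :
    ∃ φ, Potential x {k | x.right.SameCycle i k} φ := by
  classical
  set p := Function.minimalPeriod x.right i with hp
  have per : ∀ a, (x ^ (a + p)).left ((x.right ^ (a + p)) i) =
      (x ^ a).left ((x.right ^ a) i) := by
    intro a
    have h1 : (x.right ^ (a + p)) i = (x.right ^ a) i := by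
      rw [pow_add, Equiv.Perm.mul_apply, pow_period]
    rw [h1, pow_add, left_mul, right_pow,
      show (x.right ^ a)⁻¹ ((x.right ^ a) i) = i from (x.right ^ a).symm_apply_apply i,
      show (x ^ p).left i = 1 from h, mul_one]
  have per' : ∀ q a, (x ^ (a + p * q)).left ((x.right ^ (a + p * q)) i) =
      (x ^ a).left ((x.right ^ a) i) := by
    intro q a
    induction q with
    | zero => simp
    | succ q ih => rw [Nat.mul_succ, ← add_assoc, per, ih]
  have wd : ∀ a b, (x.right ^ a) i = (x.right ^ b) i →
      (x ^ a).left ((x.right ^ a) i) = (x ^ b).left ((x.right ^ b) i) := by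
    intro a b hab
    have hmod : a % p = b % p := by
      rw [← Equiv.Perm.iterate_eq_pow, ← Equiv.Perm.iterate_eq_pow] at hab
      have hpp : 0 < p := Function.minimalPeriod_pos_of_mem_periodicPts
        (Function.Injective.mem_periodicPts x.right.injective i)
      refine Function.iterate_injOn_Iio_minimalPeriod (f := x.right) (x := i)
        (Nat.mod_lt _ hpp) (Nat.mod_lt _ hpp) ?_
      show x.right^[a % p] i = x.right^[b % p] i
      rw [Function.iterate_mod_minimalPeriod_eq, Function.iterate_mod_minimalPeriod_eq, hab]
    rw [← Nat.mod_add_div a p, ← Nat.mod_add_div b p, per', per', hmod]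
  have ex : ∀ k, ∃ a : ℕ, x.right.SameCycle i k → (x.right ^ a) i = k := by
    intro k
    by_cases hk : x.right.SameCycle i k
    · obtain ⟨a, -, -, ha⟩ := hk.exists_pow_eq
      exact ⟨a, fun _ => ha⟩
    · exact ⟨0, fun h => absurd h hk⟩
  choose a ha using ex
  refine ⟨fun k => (x ^ a k).left k, fun k hk => ?_⟩
  have hk' : x.right.SameCycle i (x.right k) := Equiv.Perm.sameCycle_apply_right.2 hk
  refine ⟨hk', ?_⟩
  have e1 := ha _ hk'
  have e2 : (x.right ^ (a k + 1)) i = x.right k := by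
    rw [pow_succ', Equiv.Perm.mul_apply, ha _ hk]
  have := wd _ _ (e1.trans e2.symm)
  rw [e1, e2] at this
  show (x ^ a (x.right k)).left (x.right k) = _
  rw [this, pow_succ', left_mul]
  simp

theorem Potential.mul_right {x : Wreath Γ n} {C : Set (Fin n)} {φ : Fin n → Γ}
    (h : Potential x C φ) (a : Γ) : Potential x C fun k => φ k * a :=
  fun k hk => ⟨(h k hk).1, by
    show φ _ * a = _ * (φ k * a)
    rw [(h k hk).2, mul_assoc]⟩

/-- The factors `s`: they involve at most two letters `i`, `j`, and a transposition `(i j)`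
has trivial cycle-product. -/
structure IsStep (s : Wreath Γ n) (i j : Fin n) : Prop where
  right_eq : s.right = Equiv.swap i j
  left_eq : ∀ k, k ≠ i → k ≠ j → s.left k = 1
  left_mul : i ≠ j → s.left i * s.left j = 1

theorem Potential.step {s x : Wreath Γ n} {i j : Fin n} (hs : IsStep s i j) {C : Set (Fin n)}
    {φ : Fin n → Γ} (h : Potential x C φ) (hij : i ∈ C ↔ j ∈ C)
    (hi : i ∈ C → φ i = s.left i * φ j) (hj : j ∈ C → φ j = s.left j * φ i) :
    Potential (s * x) C φ := by
  intro k hk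
  obtain ⟨h1, h2⟩ := h k hk
  have hr : (s * x).right k = Equiv.swap i j (x.right k) := by
    rw [SemidirectProduct.mul_right, hs.right_eq]; rfl
  have hl : (s * x).left ((s * x).right k) = s.left (Equiv.swap i j (x.right k)) *
      x.left (x.right k) := by
    rw [FarahatHigman.left_mul, hr, hs.right_eq]
    simp
  rw [hl, hr]
  by_cases e1 : x.right k = i
  · rw [e1] at h1 h2 ⊢
    rw [Equiv.swap_apply_left, mul_assoc, ← h2]
    exact ⟨hij.1 h1, hj (hij.1 h1)⟩
  by_cases e2 : x.right k = j
  · rw [e2] at h1 h2 ⊢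
    rw [Equiv.swap_apply_right, mul_assoc, ← h2]
    exact ⟨hij.2 h1, hi (hij.2 h1)⟩
  rw [Equiv.swap_apply_of_ne_of_ne e1 e2, hs.left_eq _ e1 e2, one_mul]
  exact ⟨h1, h2⟩

theorem cycleThrough_step {s x : Wreath Γ n} {i j : Fin n} (hs : IsStep s i j) {k : Fin n}
    (hi : i ∉ cycleThrough x.right k) (hj : j ∉ cycleThrough x.right k) :
    cycleThrough (s * x).right k = cycleThrough x.right k := by
  have hpow : ∀ m : ℕ, ((s * x).right ^ m) k = (x.right ^ m) k := by
    intro m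
    induction m with
    | zero => rfl
    | succ m ih =>
      have hc : (x.right ^ (m + 1)) k ∈ cycleThrough x.right k :=
        mem_cycleThrough.2 ⟨(m + 1 : ℕ), by rw [zpow_natCast]⟩
      rw [pow_succ', pow_succ', Equiv.Perm.mul_apply, Equiv.Perm.mul_apply, ih,
        SemidirectProduct.mul_right, hs.right_eq, Equiv.Perm.mul_apply,
        ← Equiv.Perm.mul_apply x.right, ← pow_succ']
      exact Equiv.swap_apply_of_ne_of_ne (fun h => hi (h ▸ hc)) (fun h => hj (h ▸ hc))
  ext l
  rw [mem_cycleThrough, mem_cycleThrough]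
  constructor
  · intro h
    obtain ⟨m, -, -, rfl⟩ := h.exists_pow_eq
    exact ⟨m, by rw [zpow_natCast, hpow]⟩
  · intro h
    obtain ⟨m, -, -, rfl⟩ := h.exists_pow_eq
    exact ⟨m, by rw [zpow_natCast, hpow]⟩

/-- The trivial cycles avoiding `i` and `j`. -/
noncomputable def flatOff (x : Wreath Γ n) (i j : Fin n) : Finset (Finset (Fin n)) :=
  (cyclesIn x (idClass Γ)).filter fun C => i ∉ C ∧ j ∉ C

theorem flatOff_subset {s x : Wreath Γ n} {i j : Fin n} (hs : IsStep s i j) :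
    flatOff x i j ⊆ flatOff (s * x) i j := by
  intro C hC
  obtain ⟨hC, hi, hj⟩ := Finset.mem_filter.1 hC
  obtain ⟨k, rfl⟩ := mem_cycles.1 (mem_cyclesIn.1 hC).1
  refine Finset.mem_filter.2 ⟨?_, hi, hj⟩
  rw [← cycleThrough_step hs hi hj, mem_flat]
  obtain ⟨φ, hφ⟩ := exists_potential (mem_flat.1 hC)
  rw [mem_cycleThrough] at hi hj
  exact (hφ.step hs (iff_of_false hi hj) (fun h => absurd h hi) (fun h => absurd h hj)).loopLabel_eq
    (Equiv.Perm.SameCycle.refl _ _)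

/-- Left multiplication by a step removes at most one trivial cycle. -/
theorem flat_le_step {s x : Wreath Γ n} {i j : Fin n} (hs : IsStep s i j) :
    flat x ≤ flat (s * x) + 1 := by
  classical
  have hsub : cyclesIn x (idClass Γ) ⊆
      flatOff x i j ∪ {cycleThrough x.right i, cycleThrough x.right j} := by
    intro C hC
    by_cases h : i ∉ C ∧ j ∉ C
    · exact Finset.mem_union_left _ (Finset.mem_filter.2 ⟨hC, h⟩)
    · obtain ⟨k, rfl⟩ := mem_cycles.1 (mem_cyclesIn.1 hC).1
      simp only [mem_cycleThrough] at h
      simp only [Finset.mem_union, Finset.mem_insert, Finset.mem_singleton, cycleThrough_eq_iff]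
      tauto
  have hoff : (flatOff (s * x) i j).card ≤ flat (s * x) :=
    Finset.card_le_card (Finset.filter_subset _ _)
  have hle := Finset.card_le_card (flatOff_subset (x := x) hs)
  by_cases hij : x.right.SameCycle i j
  · rw [cycleThrough_eq_iff.2 hij, Finset.pair_eq_singleton] at hsub
    have := (Finset.card_le_card hsub).trans (Finset.card_union_le _ _)
    rw [Finset.card_singleton] at this
    unfold flat at *
    omega
  by_cases hb : loopLabel x i = 1 ∧ loopLabel x j = 1
  · have h2 := (Finset.card_le_card hsub).trans (Finset.card_union_le _ _)
    have h3 : ({cycleThrough x.right i, cycleThrough x.right j} : Finset _).card ≤ 2 :=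
      Finset.card_le_two
    suffices (flatOff (s * x) i j).card + 1 ≤ flat (s * x) by unfold flat at *; omega
    obtain ⟨φ, hφ⟩ := exists_potential hb.1
    obtain ⟨ψ, hψ⟩ := exists_potential hb.2
    have hne : i ≠ j := fun h => hij (h ▸ Equiv.Perm.SameCycle.refl _ _)
    set a := (ψ j)⁻¹ * (s.left j * φ i) with ha
    have hpot : Potential x ({k | x.right.SameCycle i k} ∪ {k | x.right.SameCycle j k})
        (fun k => if x.right.SameCycle i k then φ k else ψ k * a) := by
      intro k hk
      by_cases hki : x.right.SameCycle i k
      · have hk' := (hφ k hki).1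
        refine ⟨Or.inl hk', ?_⟩
        beta_reduce
        rw [if_pos (show x.right.SameCycle i (x.right k) from hk'), if_pos hki]
        exact (hφ k hki).2
      · have hkj : x.right.SameCycle j k := hk.resolve_left hki
        have hk' := (hψ k hkj).1
        refine ⟨Or.inr hk', ?_⟩
        beta_reduce
        rw [if_neg (fun h => hki (Equiv.Perm.sameCycle_apply_right.1 h)), if_neg hki]
        exact (hψ.mul_right a k hkj).2
    have hii : x.right.SameCycle i i := Equiv.Perm.SameCycle.refl _ _
    have hjj : x.right.SameCycle j j := Equiv.Perm.SameCycle.refl _ _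
    have hval : ψ j * a = s.left j * φ i := by rw [ha]; group
    have hst := hpot.step hs (iff_of_true (Or.inl hii) (Or.inr hjj))
      (fun _ => by
        simp only [if_pos hii, if_neg hij, hval]
        rw [← mul_assoc, hs.left_mul hne, one_mul])
      (fun _ => by simp only [if_pos hii, if_neg hij, hval])
    have hmem := mem_flat.2 (hst.loopLabel_eq (Or.inl hii))
    refine Finset.card_lt_card ((Finset.ssubset_iff_of_subset (Finset.filter_subset _ _)).2
      ⟨_, hmem, fun h => (Finset.mem_filter.1 h).2.1 (self_mem_cycleThrough _ _)⟩)
  · have : ∃ D, cyclesIn x (idClass Γ) ⊆ flatOff x i j ∪ {D} := by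
      by_cases h1 : loopLabel x i = 1
      · refine ⟨cycleThrough x.right i, fun C hC => ?_⟩
        have := hsub hC
        simp only [Finset.mem_union, Finset.mem_insert, Finset.mem_singleton] at this ⊢
        rcases this with h | h | h
        · exact Or.inl h
        · exact Or.inr h
        · exact absurd ⟨h1, mem_flat.1 (h ▸ hC)⟩ hb
      · refine ⟨cycleThrough x.right j, fun C hC => ?_⟩
        have := hsub hC
        simp only [Finset.mem_union, Finset.mem_insert, Finset.mem_singleton] at this ⊢
        rcases this with h | h | h
        · exact Or.inl h
        · exact absurd (mem_flat.1 (h ▸ hC)) h1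
        · exact Or.inr h
    obtain ⟨D, hD⟩ := this
    have := (Finset.card_le_card hD).trans (Finset.card_union_le _ _)
    rw [Finset.card_singleton] at this
    unfold flat at *
    omega

theorem IsStep.inv {s : Wreath Γ n} {i j : Fin n} (hs : IsStep s i j) : IsStep s⁻¹ i j := by
  have hl : ∀ k, s⁻¹.left k = (s.left (Equiv.swap i j k))⁻¹ := by
    intro k
    rw [← hs.right_eq]
    rfl
  refine ⟨?_, fun k h1 h2 => ?_, fun h => ?_⟩
  · rw [SemidirectProduct.inv_right, hs.right_eq, Equiv.swap_inv]
  · rw [hl, Equiv.swap_apply_of_ne_of_ne h1 h2, hs.left_eq k h1 h2, inv_one]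
  · rw [hl, hl, Equiv.swap_apply_left, Equiv.swap_apply_right, ← mul_inv_rev, hs.left_mul h,
      inv_one]

theorem exists_step {x : Wreath Γ n} (hx : x ≠ 1) :
    ∃ (s : Wreath Γ n) (i j : Fin n), IsStep s i j ∧ flat x + 1 ≤ flat (s * x) := by
  classical
  have main : ∀ (s : Wreath Γ n) (i : Fin n), IsStep s i (x.right i) →
      s.left i * x.left (x.right i) = 1 →
      (loopLabel x i = 1 → x.right i ≠ i) → flat x + 1 ≤ flat (s * x) := by
    intro s i hs h1 hl
    have hfix : (s * x).right i = i := by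
      rw [SemidirectProduct.mul_right, hs.right_eq]
      simp
    have hsub : cyclesIn x (idClass Γ) ⊆
        flatOff x i (x.right i) ∪ {cycleThrough x.right i} := by
      intro C hC
      by_cases h : i ∉ C ∧ x.right i ∉ C
      · exact Finset.mem_union_left _ (Finset.mem_filter.2 ⟨hC, h⟩)
      · obtain ⟨k, rfl⟩ := mem_cycles.1 (mem_cyclesIn.1 hC).1
        simp only [mem_cycleThrough, Equiv.Perm.sameCycle_apply_right] at h
        simp only [Finset.mem_union, Finset.mem_singleton, cycleThrough_eq_iff]
        tauto
    have hi : cycleThrough (s * x).right i ∈ cyclesIn (s * x) (idClass Γ) := by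
      rw [mem_flat]
      refine Potential.loopLabel_eq (C := {i}) (φ := fun _ => 1) (fun k hk => ?_) rfl
      rw [Set.mem_singleton_iff.1 hk, hfix]
      refine ⟨rfl, ?_⟩
      rw [left_mul, hs.right_eq, Equiv.swap_inv, Equiv.swap_apply_left, h1, mul_one]
    have hin : i ∈ cycleThrough (s * x).right i := self_mem_cycleThrough _ _
    have hle := flatOff_subset (x := x) hs
    by_cases hb : loopLabel x i = 1
    · have hj : cycleThrough (s * x).right (x.right i) ∈ cyclesIn (s * x) (idClass Γ) := by
        obtain ⟨φ, hφ⟩ := exists_potential hb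
        have hii : x.right.SameCycle i i := Equiv.Perm.SameCycle.refl _ _
        have h2 := hφ i hii
        have h3 : s.left (x.right i) = x.left (x.right i) := by
          have := hs.left_mul (hl hb).symm
          exact mul_left_cancel (this.trans h1.symm)
        rw [mem_flat]
        refine (hφ.step hs (iff_of_true hii h2.1) (fun _ => ?_) (fun _ => ?_)).loopLabel_eq h2.1
        · rw [h2.2, ← mul_assoc, h1, one_mul]
        · rw [h2.2, h3]
      have hne : cycleThrough (s * x).right i ≠ cycleThrough (s * x).right (x.right i) := by
        intro h
        exact hl hb (((cycleThrough_eq_iff.1 h).eq_of_left hfix).symm)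
      have hjn : x.right i ∈ cycleThrough (s * x).right (x.right i) := self_mem_cycleThrough _ _
      have h4 : flatOff x i (x.right i) ∪
          {cycleThrough (s * x).right i, cycleThrough (s * x).right (x.right i)} ⊆
          cyclesIn (s * x) (idClass Γ) := by
        refine Finset.union_subset (hle.trans (Finset.filter_subset _ _)) ?_
        intro C hC
        rcases Finset.mem_insert.1 hC with rfl | hC
        · exact hi
        · rw [Finset.mem_singleton.1 hC]; exact hj
      have h5 := Finset.card_le_card h4
      rw [Finset.card_union_of_disjoint, Finset.card_pair hne] at h5
      · have := (Finset.card_le_card hsub).trans (Finset.card_union_le _ _)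
        rw [Finset.card_singleton] at this
        unfold flat
        omega
      · refine Finset.disjoint_left.2 fun C hC hC' => ?_
        obtain ⟨-, ha, hb⟩ := Finset.mem_filter.1 hC
        rcases Finset.mem_insert.1 hC' with rfl | hC'
        · exact ha hin
        · rw [Finset.mem_singleton.1 hC'] at hb
          exact hb hjn
    · have h4 : cyclesIn x (idClass Γ) ⊆ flatOff x i (x.right i) := by
        intro C hC
        rcases Finset.mem_union.1 (hsub hC) with h | h
        · exact h
        · rw [Finset.mem_singleton.1 h, mem_flat] at hC
          exact absurd hC hb
      exact Finset.card_lt_card ((Finset.ssubset_iff_of_subset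
        ((h4.trans hle).trans (Finset.filter_subset _ _))).2
        ⟨_, hi, fun h => (Finset.mem_filter.1 (hle (h4 h))).2.1 hin⟩)
  by_cases hr : ∃ i, x.right i ≠ i
  · obtain ⟨i, hi⟩ := hr
    refine ⟨⟨Pi.mulSingle i (x.left (x.right i))⁻¹ *
      Pi.mulSingle (x.right i) (x.left (x.right i)), Equiv.swap i (x.right i)⟩, i, x.right i,
      ⟨rfl, fun k h1 h2 => ?_, fun h => ?_⟩, main _ _ ⟨rfl, fun k h1 h2 => ?_, fun h => ?_⟩ ?_
        fun _ => hi⟩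
    all_goals simp [*, hi.symm]
  · push Not at hr
    obtain ⟨i, hi⟩ : ∃ i, x.left i ≠ 1 := by
      by_contra! h
      exact hx (SemidirectProduct.ext (funext h) (Equiv.ext hr))
    have hs : IsStep (⟨Pi.mulSingle i (x.left i)⁻¹, 1⟩ : Wreath Γ n) i (x.right i) := by
      refine ⟨by rw [hr, Equiv.swap_self]; rfl, fun k h1 h2 => by simp [h1], fun h => ?_⟩
      exact absurd (hr i).symm h
    refine ⟨_, i, x.right i, hs, main _ _ hs (by simp [hr]) fun h => absurd ?_ hi⟩
    have hp : Function.minimalPeriod x.right i = 1 :=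
      Function.minimalPeriod_eq_one_iff_isFixedPt.2 (hr i)
    unfold loopLabel at h
    rwa [hp, pow_one] at h

theorem norm_mul_le [Finite Γ] (x y : Wreath Γ n) :
    elemDegree (x * y) ≤ elemDegree x + elemDegree y := by
  induction hN : elemDegree x using Nat.strong_induction_on generalizing x y with
  | _ N ih =>
    by_cases hx : x = 1
    · subst hx; simp
    · obtain ⟨s, i, j, hs, h⟩ := exists_step hx
      have h1 := norm_add_flat x
      have h2 := norm_add_flat (s * x)
      have h3 := norm_add_flat (x * y)
      have h4 := norm_add_flat (s * x * y)
      have h5 := ih _ (by omega) (s * x) y rfl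
      have h7 := norm_add_flat y
      have h6 := flat_le_step (x := s * x * y) hs.inv
      rw [mul_assoc s x y, inv_mul_cancel_left] at h6
      rw [mul_assoc s x y] at h4 h5
      omega

theorem norm_one [Finite Γ] : elemDegree (1 : Wreath Γ n) = 0 := by
  have h : flat (1 : Wreath Γ n) = n := by
    have h1 : cyclesIn (1 : Wreath Γ n) (idClass Γ) = Finset.univ.map
        ⟨fun i : Fin n => {i}, Finset.singleton_injective⟩ := by
      have h2 : ∀ i : Fin n, cycleThrough (1 : Wreath Γ n).right i = {i} := by
        intro i
        ext j
        rw [mem_cycleThrough, SemidirectProduct.one_right, Equiv.Perm.sameCycle_one,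
          Finset.mem_singleton, eq_comm]
      ext C
      simp only [Finset.mem_map, Finset.mem_univ, true_and, Function.Embedding.coeFn_mk]
      constructor
      · intro hC
        obtain ⟨i, rfl⟩ := mem_cycles.1 (mem_cyclesIn.1 hC).1
        exact ⟨i, (h2 i).symm⟩
      · rintro ⟨i, rfl⟩
        rw [← h2 i, mem_flat]
        simp [loopLabel]
    rw [flat, h1, Finset.card_map, Finset.card_univ, Fintype.card_fin]
  have := norm_add_flat (1 : Wreath Γ n)
  omega

end Cycles

section AssociatedGraded

variable {R : Type*} [CommRing R] (F Flt : ℕ → AddSubgroup R)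

/-- The degree `k` piece `F_k / F_{<k}` of the associated graded ring of a filtered ring. -/
def GrPiece (k : ℕ) : Type _ := F k ⧸ (Flt k).addSubgroupOf (F k)

instance (k : ℕ) : AddCommGroup (GrPiece F Flt k) :=
  inferInstanceAs (AddCommGroup (F k ⧸ (Flt k).addSubgroupOf (F k)))

/-- The symbol of `f ∈ F_k` in degree `k`. -/
def symb (k : ℕ) : F k →+ GrPiece F Flt k := QuotientAddGroup.mk' ((Flt k).addSubgroupOf (F k))

variable {F Flt}

theorem symb_surjective (k : ℕ) : Function.Surjective (symb F Flt k) :=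
  QuotientAddGroup.mk'_surjective _

theorem symb_eq_zero {k : ℕ} {f : F k} : symb F Flt k f = 0 ↔ (f : R) ∈ Flt k :=
  (QuotientAddGroup.eq_zero_iff f).trans AddSubgroup.mem_addSubgroupOf

theorem lt_mul_mem [IsRingFiltration F Flt] {i j : ℕ} {f g : R} (hf : f ∈ Flt i) (hg : g ∈ F j) :
    f * g ∈ Flt (i + j) := by
  have h : Flt i ≤ (Flt (i + j)).comap (AddMonoidHom.mulRight g) := by
    refine IsFiltration.is_sup (F := F) _ _ fun k hk r hr => ?_
    exact IsFiltration.is_le (F := F) (Nat.add_lt_add_right hk j)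
      (SetLike.GradedMul.mul_mem hr hg)
  exact h hf

variable (F Flt)

/-- The product of elements of `F_i` and `F_j`, as an element of `F_{i + j}`. -/
def filMul [IsRingFiltration F Flt] (i j : ℕ) : F i →+ F j →+ F (i + j) :=
  AddMonoidHom.mk' (fun f => AddMonoidHom.mk'
    (fun g => ⟨f * g, SetLike.GradedMul.mul_mem f.2 g.2⟩)
    (fun g h => Subtype.ext (mul_add (f : R) g h)))
    (fun f g => by ext h; exact add_mul (f : R) g h)

/-- Multiplication of symbols: the symbol of `f` in degree `i` times the symbol of `g` in degree
`j` is the symbol of `f g` in degree `i + j`. -/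
def grMul [IsRingFiltration F Flt] (i j : ℕ) :
    GrPiece F Flt i →+ GrPiece F Flt j →+ GrPiece F Flt (i + j) :=
  QuotientAddGroup.lift _
    (AddMonoidHom.mk' (fun f => QuotientAddGroup.lift _
      ((symb F Flt (i + j)).comp (filMul F Flt i j f))
      (fun g hg => symb_eq_zero.2 (by
        have := lt_mul_mem (F := F) (AddSubgroup.mem_addSubgroupOf.1 hg) f.2
        rw [mul_comm, add_comm] at this
        exact this)))
      (fun f g => by
        refine QuotientAddGroup.addMonoidHom_ext _ ?_
        ext h
        exact (congrArg (symb F Flt (i + j)) (congrArg (fun φ => φ h)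
          (map_add (filMul F Flt i j) f g))).trans (map_add _ _ _)))
    (fun f hf => by
      refine QuotientAddGroup.addMonoidHom_ext _ ?_
      ext g
      exact symb_eq_zero.2 (lt_mul_mem (F := F) (AddSubgroup.mem_addSubgroupOf.1 hf) g.2))

theorem grMul_symb [IsRingFiltration F Flt] (i j : ℕ) (f : F i) (g : F j) :
    grMul F Flt i j (symb F Flt i f) (symb F Flt j g) =
      symb F Flt (i + j) ⟨f * g, SetLike.GradedMul.mul_mem f.2 g.2⟩ := rfl

theorem symb_sigma_eq {i j : ℕ} (h : i = j) {f : F i} {g : F j} (hfg : (f : R) = g) :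
    (⟨i, symb F Flt i f⟩ : GradedMonoid (GrPiece F Flt)) = ⟨j, symb F Flt j g⟩ := by
  subst h
  rw [Subtype.ext hfg]

instance [IsRingFiltration F Flt] : GradedMonoid.GMul (GrPiece F Flt) where
  mul {i j} a b := grMul F Flt i j a b

instance [IsRingFiltration F Flt] : GradedMonoid.GOne (GrPiece F Flt) where
  one := symb F Flt 0 ⟨1, SetLike.GradedOne.one_mem⟩

instance [IsRingFiltration F Flt] : DirectSum.GCommRing (GrPiece F Flt) where
  mul_zero a := map_zero _
  zero_mul {i j} b := by
    show grMul F Flt i j 0 b = 0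
    rw [map_zero, AddMonoidHom.zero_apply]
  mul_add a b c := map_add _ _ _
  add_mul {i j} a b c := by
    show grMul F Flt i j (a + b) c = _
    rw [map_add]
    rfl
  one_mul := by
    rintro ⟨i, a⟩
    obtain ⟨f, rfl⟩ := symb_surjective i a
    exact symb_sigma_eq F Flt (zero_add i) (one_mul (f : R))
  mul_one := by
    rintro ⟨i, a⟩
    obtain ⟨f, rfl⟩ := symb_surjective i a
    exact symb_sigma_eq F Flt (add_zero i) (mul_one (f : R))
  mul_assoc := by
    rintro ⟨i, a⟩ ⟨j, b⟩ ⟨k, c⟩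
    obtain ⟨f, rfl⟩ := symb_surjective i a
    obtain ⟨g, rfl⟩ := symb_surjective j b
    obtain ⟨h, rfl⟩ := symb_surjective k c
    exact symb_sigma_eq F Flt (add_assoc i j k) (mul_assoc (f : R) g h)
  mul_comm := by
    rintro ⟨i, a⟩ ⟨j, b⟩
    obtain ⟨f, rfl⟩ := symb_surjective i a
    obtain ⟨g, rfl⟩ := symb_surjective j b
    exact symb_sigma_eq F Flt (add_comm i j) (mul_comm (f : R) g)
  natCast m := m • symb F Flt 0 ⟨1, SetLike.GradedOne.one_mem⟩
  natCast_zero := zero_smul _ _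
  natCast_succ m := succ_nsmul _ m
  intCast m := m • symb F Flt 0 ⟨1, SetLike.GradedOne.one_mem⟩
  intCast_ofNat m := natCast_zsmul _ m
  intCast_negSucc_ofNat m := negSucc_zsmul _ m

/-- The associated graded ring `⨁ₖ F_k / F_{<k}` of a filtered ring. -/
abbrev AssocGraded : Type _ := ⨁ k, GrPiece F Flt k

end AssociatedGraded

noncomputable instance (Γ : Type*) [Group Γ] [Finite Γ] (n : ℕ) : Fintype (Wreath Γ n) := by
  have : Finite (Wreath Γ n) := Finite.of_equiv _ SemidirectProduct.equivProd.symm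
  exact Fintype.ofFinite _

/-- The class algebra `R_ℤ(Γₙ)`: integral class functions with the convolution product, that is,
the centre of the group ring `ℤ[Γₙ]`. -/
abbrev ClassAlg (Γ : Type*) [Group Γ] (n : ℕ) : Type _ :=
  Subring.center (MonoidAlgebra ℤ (Wreath Γ n))

section ClassAlgebra

variable {Γ : Type*} [Group Γ] [Finite Γ] {n : ℕ}

open scoped Classical in
/-- The sum in `ℤ[Γₙ]` of all elements of `Γₙ` of modified type `ρ`. -/
noncomputable def classSum (n : ℕ) (ρ : PartFun Γ) : MonoidAlgebra ℤ (Wreath Γ n) :=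
  ∑ x : Wreath Γ n with modifiedType x = ρ, MonoidAlgebra.single x 1

theorem classSum_mem_center (ρ : PartFun Γ) :
    classSum n ρ ∈ Subring.center (MonoidAlgebra ℤ (Wreath Γ n)) := by
  classical
  rw [Subring.mem_center_iff]
  intro f
  induction f using MonoidAlgebra.induction_on with
  | of z =>
    simp only [classSum, Finset.mul_sum, Finset.sum_mul, MonoidAlgebra.of_apply,
      MonoidAlgebra.single_mul_single, one_mul]
    refine Finset.sum_bij' (fun x _ => z * x * z⁻¹) (fun x _ => z⁻¹ * x * z) ?_ ?_ ?_ ?_ ?_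
    · intro x hx
      simpa [modifiedType_conj] using hx
    · intro x hx
      have := modifiedType_conj z⁻¹ x
      rw [inv_inv] at this
      simpa [this] using hx
    · intro x _
      group
    · intro x _
      group
    · intro x _
      simp
  | add f g hf hg => rw [add_mul, mul_add, hf, hg]
  | smul r f hf => rw [smul_mul_assoc, mul_smul_comm, hf]

/-- `K_ρ(n)` in the class algebra of `Γₙ`. -/
noncomputable def classK (n : ℕ) (ρ : PartFun Γ) : ClassAlg Γ n :=
  ⟨classSum n ρ, classSum_mem_center ρ⟩

variable (Γ n)

/-- The filtration of the class algebra: `F_k` consists of the class functions supported on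
elements of degree at most `k` (equivalently, the span of the `K_ρ(n)` with `‖ρ‖ ≤ k`). -/
def fil (k : ℕ) : AddSubgroup (ClassAlg Γ n) where
  carrier := {f | ∀ x, f.1.coeff x ≠ 0 → elemDegree x ≤ k}
  zero_mem' := fun x hx => absurd rfl hx
  add_mem' := by
    intro f g hf hg x hx
    by_cases h : f.1.coeff x = 0
    · refine hg x fun h' => hx ?_
      simp [h, h']
    · exact hf x h
  neg_mem' := by
    intro f hf x hx
    exact hf x fun h => hx (by simp [h])

/-- `F_{<k}`: the class functions supported on elements of degree less than `k`. -/
def filLT (k : ℕ) : AddSubgroup (ClassAlg Γ n) where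
  carrier := {f | ∀ x, f.1.coeff x ≠ 0 → elemDegree x < k}
  zero_mem' := fun x hx => absurd rfl hx
  add_mem' := by
    intro f g hf hg x hx
    by_cases h : f.1.coeff x = 0
    · refine hg x fun h' => hx ?_
      simp [h, h']
    · exact hf x h
  neg_mem' := by
    intro f hf x hx
    exact hf x fun h => hx (by simp [h])

instance : IsRingFiltration (fil Γ n) (filLT Γ n) where
  mono := fun _ _ h _ hf x hx => (hf x hx).trans h
  is_le := fun h _ hf x hx => (hf x hx).trans_lt h
  is_sup := by
    intro B j hB f hf
    cases j with
    | zero =>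
      have : f = 0 := by
        apply Subtype.ext
        ext x
        by_contra h
        exact absurd (hf x h) (Nat.not_lt_zero _)
      rw [this]
      exact zero_mem _
    | succ j => exact hB j (Nat.lt_succ_self j) fun x hx => Nat.le_of_lt_succ (hf x hx)
  one_mem := by
    classical
    intro x hx
    rw [show ((1 : ClassAlg Γ n).1) = MonoidAlgebra.single 1 1 from rfl] at hx
    by_cases h : x = 1
    · rw [h, norm_one]
    · exact absurd (by simp [MonoidAlgebra.coeff_single, Ne.symm h]) hx
  mul_mem := by
    classical
    intro i j f g hf hg x hx
    have hx' : x ∈ (f.1 * g.1).coeff.support := Finsupp.mem_support_iff.2 hx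
    obtain ⟨y, hy, z, hz, rfl⟩ := Finset.mem_mul.1 (MonoidAlgebra.support_coeff_mul_subset f.1 g.1 hx')
    exact (norm_mul_le y z).trans
      (Nat.add_le_add (hf y (Finsupp.mem_support_iff.1 hy)) (hg z (Finsupp.mem_support_iff.1 hz)))

variable {Γ}

theorem classK_mem_fil (ρ : PartFun Γ) : classK n ρ ∈ fil Γ n (degree ρ) := by
  classical
  intro x hx
  have : modifiedType x = ρ := by
    by_contra h
    apply hx
    show (classSum n ρ).coeff x = 0
    rw [classSum, MonoidAlgebra.coeff_sum, Finsupp.finsetSum_apply]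
    refine Finset.sum_eq_zero fun y hy => ?_
    rw [MonoidAlgebra.coeff_single, Finsupp.single_apply, if_neg]
    rintro rfl
    exact h (Finset.mem_filter.1 hy).2
  rw [elemDegree, this]

end ClassAlgebra

section Rings

variable (Γ : Type*) [Group Γ] [Finite Γ]

/-- The graded ring `𝒢_Γ(n)` associated with the filtered ring `R_ℤ(Γₙ)`. -/
abbrev GrRing (n : ℕ) : Type _ := AssocGraded (fil Γ n) (filLT Γ n)

noncomputable instance (n : ℕ) : CommRing (GrRing Γ n) := DirectSum.commRing _

variable {Γ}

/-- `K_ρ(n)` in `𝒢_Γ(n)`, homogeneous of degree `‖ρ‖`. -/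
noncomputable def grK (n : ℕ) (ρ : PartFun Γ) : GrRing Γ n :=
  DirectSum.of (GrPiece (fil Γ n) (filLT Γ n)) (degree ρ)
    (symb (fil Γ n) (filLT Γ n) (degree ρ) ⟨classK n ρ, classK_mem_fil n ρ⟩)

variable (Γ)

/-- The Farahat–Higman ring `𝒢_Γ`, realised as the subring of `∏ₙ 𝒢_Γ(n)` generated by the
families `K_ρ = (K_ρ(n))ₙ`. (That the `K_ρ` form a `ℤ`-basis whose structure constants are the
stable ones of the rings `R_ℤ(Γₙ)` is part of what the theorem asserts.) -/
abbrev FHRing : Type _ := Subring.closure (Set.range fun (ρ : PartFun Γ) (n : ℕ) => grK n ρ)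

variable {Γ}

/-- `K_ρ` in `𝒢_Γ`. -/
noncomputable def fhK (ρ : PartFun Γ) : FHRing Γ :=
  ⟨fun n => grK n ρ, Subring.subset_closure ⟨ρ, rfl⟩⟩

variable (Γ)

/-- The degree `k` part of `𝒢_Γ`, spanned by the `K_ρ` with `‖ρ‖ = k`. -/
noncomputable def fhGrade (k : ℕ) : AddSubgroup (FHRing Γ) :=
  AddSubgroup.closure {a | ∃ ρ : PartFun Γ, degree ρ = k ∧ a = fhK ρ}

variable {Γ}

/-- `ρ` has a nontrivial cycle-product, i.e. `ρ ≠ ρ(c⁰)`. -/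
def HasNontrivial (ρ : PartFun Γ) : Prop := ∃ c, c ≠ idClass Γ ∧ (ρ c).1 ≠ 0

variable (Γ)

open scoped Classical in
/-- The partition-valued function with value `p` at `c⁰` and the empty partition elsewhere. -/
noncomputable def atId (p : IntPartition) : PartFun Γ :=
  fun c => if c = idClass Γ then p else ⟨0, by simp⟩

/-- `ℐ_Γ(n)`: the span of the `K_ρ(n)` such that `ρ` has a nontrivial cycle-product. -/
noncomputable def grI (n : ℕ) : AddSubgroup (GrRing Γ n) :=
  AddSubgroup.closure {a | ∃ ρ : PartFun Γ, HasNontrivial ρ ∧ a = grK n ρ}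

/-- `ℐ_Γ`: the span of the `K_ρ` such that `ρ` has a nontrivial cycle-product. -/
noncomputable def fhI : AddSubgroup (FHRing Γ) :=
  AddSubgroup.closure {a | ∃ ρ : PartFun Γ, HasNontrivial ρ ∧ a = fhK ρ}

end Rings

end FarahatHigman

open FarahatHigman

/-! The isomorphisms come from restricting coefficients along the inclusion of $S_n$ in $\Gamma_n$.
On class algebras this restriction is not multiplicative, but on associated graded rings it is. By
`grEval_mul`, the coefficient at $z$ of a product of symbols is a convolution over the
factorisations $z = xy$ with $\|x\|+\|y\|=\|z\|$ only. If $z$ lies in $S_n$, both factors of such a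
factorisation lie in $S_n$ (`eq_inr_of_geodesic`). Restriction sends $K_p$ to $K_p$ and kills every
$K_\lambda$ with a nontrivial cycle-product. Its kernel is exactly the span of the latter, because a
type concentrated at $c^0$ that occurs in $\Gamma_n$ already occurs in $S_n$.

The geometric input is `Potential.of_geodesic`. A potential is a gauge in which all labels over an
invariant set of letters become trivial. Since $\|x\|$ is $n$ minus the number of cycles with
trivial cycle-product, an additive factorisation can be peeled step by step, and each step must
raise the number of trivial cycles of what remains of the product. A step that does so respects
every potential of the element it multiplies (`Potential.of_flat_lt`), so the left factor inherits
every potential of the product. The constant potential 1 on all letters gives the statement about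
$S_n$.

The same potential on a single letter shows that a letter fixed with label 1 by the product is fixed
with label 1 by the factors. Hence adjoining such letters does not change top-degree coefficients
(`coeff_directSum_one`). Elements of equal modified type in $\Gamma_n$ are conjugate
(`isConj_of_modifiedType_eq`), so these coefficients depend only on the types (`coeff_stable`). The
families $K_\rho$ therefore span a ring. They are independent because every $\rho$ is the modified
type of an element of some $\Gamma_n$. The restrictions at all levels then assemble to a map between
the stable rings. -/

namespace FarahatHigman

/-! ### Potentials and factorisations of additive degree -/

section Geodesics

variable {Γ : Type*} [Group Γ] {n : ℕ}

theorem Potential.one (C : Set (Fin n)) (φ : Fin n → Γ) : Potential (1 : Wreath Γ n) C φ :=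
  fun k hk => ⟨hk, by simp⟩

/-- For fixed `C` and `φ` the elements trivialised by `φ` form a subgroup of $\Gamma_n$. This is
what lets steps be peeled off and put back. -/
theorem Potential.mul {x y : Wreath Γ n} {C : Set (Fin n)} {φ : Fin n → Γ}
    (hx : Potential x C φ) (hy : Potential y C φ) : Potential (x * y) C φ := by
  intro k hk
  obtain ⟨h1, h2⟩ := hy k hk
  obtain ⟨h3, h4⟩ := hx _ h1
  refine ⟨h3, ?_⟩
  rw [SemidirectProduct.mul_right, Equiv.Perm.mul_apply, h4, h2, FarahatHigman.left_mul,
    ← mul_assoc]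
  simp

theorem Potential.inv {x : Wreath Γ n} {C : Set (Fin n)} {φ : Fin n → Γ}
    (hx : Potential x C φ) : Potential x⁻¹ C φ := by
  intro k hk
  -- `Potential` only makes `C` stable under `x.right`; on a finite set the inverse image of a
  -- letter is also reached by a nonnegative power.
  have hmem : x.right⁻¹ k ∈ C := by
    have hc : x.right.SameCycle k (x.right⁻¹ k) := ⟨-1, by simp⟩
    obtain ⟨m, -, -, hm⟩ := hc.exists_pow_eq
    rw [← hm]
    exact (hx.pow hk m).1
  refine ⟨hmem, ?_⟩
  have h := (hx _ hmem).2
  have hl : x⁻¹.left (x.right⁻¹ k) = (x.left k)⁻¹ := by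
    show (x.left (x.right (x.right⁻¹ k)))⁻¹ = _
    simp
  rw [show x.right (x.right⁻¹ k) = k from x.right.apply_symm_apply k] at h
  rw [SemidirectProduct.inv_right, hl, h]
  simp

/-- Two trivialisations over a common orbit of `x` differ by a constant. -/
theorem Potential.transport {x : Wreath Γ n} {C D : Set (Fin n)} {φ ψ : Fin n → Γ}
    (hφ : Potential x C φ) (hψ : Potential x D ψ) {i j : Fin n} (hi : i ∈ C) (hi' : i ∈ D)
    (hij : x.right.SameCycle i j) {a : Γ} (h : ψ j = a * ψ i) : j ∈ C ∧ φ j = a * φ i := by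
  obtain ⟨m, -, -, rfl⟩ := hij.exists_pow_eq
  obtain ⟨h1, h2⟩ := hφ.pow hi m
  have h3 := (hψ.pow hi' m).2
  rw [h] at h3
  exact ⟨h1, by rw [h2, ← mul_right_cancel h3]⟩

theorem IsStep.inv_left {s : Wreath Γ n} {i j : Fin n} (hs : IsStep s i j) :
    s⁻¹.left i = (s.left j)⁻¹ ∧ s⁻¹.left j = (s.left i)⁻¹ := by
  have hl : ∀ k, s⁻¹.left k = (s.left (Equiv.swap i j k))⁻¹ := by
    intro k
    rw [← hs.right_eq]
    rfl
  simp [hl]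

theorem IsStep.mul_left {s : Wreath Γ n} {i j : Fin n} (hs : IsStep s i j) (hij : i ≠ j) :
    s.left j * s.left i = 1 := by
  rw [eq_inv_of_mul_eq_one_left (hs.left_mul hij), mul_inv_cancel]

/-- Joining two trivial cycles by a step: the step is trivialised by some trivialisation of
the join. -/
theorem exists_potential_join {s x : Wreath Γ n} {i j : Fin n} (hs : IsStep s i j)
    (hij : ¬ x.right.SameCycle i j) (hi : loopLabel x i = 1) (hj : loopLabel x j = 1) :
    ∃ (D : Set (Fin n)) (ψ : Fin n → Γ), Potential (s * x) D ψ ∧ i ∈ D ∧ j ∈ D ∧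
      ψ i = s.left i * ψ j ∧ ψ j = s.left j * ψ i := by
  classical
  obtain ⟨φ, hφ⟩ := exists_potential hi
  obtain ⟨ψ, hψ⟩ := exists_potential hj
  have hne : i ≠ j := fun h => hij (h ▸ Equiv.Perm.SameCycle.refl _ _)
  -- Potentials may be rescaled on the right. This constant makes the two cycles match through `s`
  -- at `j`; the match at `i` follows because the labels of `s` at `i` and `j` are inverse to each
  -- other.
  set a := (ψ j)⁻¹ * (s.left j * φ i) with ha
  have hpot : Potential x ({k | x.right.SameCycle i k} ∪ {k | x.right.SameCycle j k})
      (fun k => if x.right.SameCycle i k then φ k else ψ k * a) := by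
    intro k hk
    by_cases hki : x.right.SameCycle i k
    · have hk' := (hφ k hki).1
      refine ⟨Or.inl hk', ?_⟩
      beta_reduce
      rw [if_pos (show x.right.SameCycle i (x.right k) from hk'), if_pos hki]
      exact (hφ k hki).2
    · have hkj : x.right.SameCycle j k := hk.resolve_left hki
      have hk' := (hψ k hkj).1
      refine ⟨Or.inr hk', ?_⟩
      beta_reduce
      rw [if_neg (fun h => hki (Equiv.Perm.sameCycle_apply_right.1 h)), if_neg hki]
      exact (hψ.mul_right a k hkj).2
  have hii : x.right.SameCycle i i := Equiv.Perm.SameCycle.refl _ _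
  have hjj : x.right.SameCycle j j := Equiv.Perm.SameCycle.refl _ _
  have hval : ψ j * a = s.left j * φ i := by rw [ha]; group
  have e1 : φ i = s.left i * (ψ j * a) := by
    rw [hval, ← mul_assoc, hs.left_mul hne, one_mul]
  exact ⟨_, _, hpot.step hs (iff_of_true (Or.inl hii) (Or.inr hjj))
      (fun _ => by simpa only [if_pos hii, if_neg hij] using e1)
      (fun _ => by simpa only [if_pos hii, if_neg hij] using hval),
    Or.inl hii, Or.inr hjj, by simpa only [if_pos hii, if_neg hij] using e1,
    by simpa only [if_pos hii, if_neg hij] using hval⟩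

theorem Potential.mem_flat {x : Wreath Γ n} {C : Set (Fin n)} {φ : Fin n → Γ}
    (h : Potential x C φ) {k : Fin n} (hk : k ∈ C) :
    cycleThrough x.right k ∈ cyclesIn x (idClass Γ) :=
  FarahatHigman.mem_flat.2 (h.loopLabel_eq hk)

theorem cyclesIn_subset_flatOff_union [DecidableEq (Finset (Fin n))] (x : Wreath Γ n)
    (i j : Fin n) : cyclesIn x (idClass Γ) ⊆
      flatOff x i j ∪ {cycleThrough x.right i, cycleThrough x.right j} := by
  intro C hC
  by_cases h : i ∉ C ∧ j ∉ C
  · exact Finset.mem_union_left _ (Finset.mem_filter.2 ⟨hC, h⟩)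
  · obtain ⟨k, rfl⟩ := mem_cycles.1 (mem_cyclesIn.1 hC).1
    simp only [mem_cycleThrough] at h
    simp only [Finset.mem_union, Finset.mem_insert, Finset.mem_singleton, cycleThrough_eq_iff]
    tauto

/-- A step that splits `z` is trivialised by every trivialisation of `z`. -/
theorem Potential.of_flat_lt {s z : Wreath Γ n} {i j : Fin n} (hs : IsStep s i j)
    (hlt : flat z < flat (s * z)) {C : Set (Fin n)} {φ : Fin n → Γ} (h : Potential z C φ) :
    Potential s C φ := by
  classical
  -- `Potential.step` applied to the identity: only the two letters moved by `s` need checking.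
  suffices hC : (i ∈ C ↔ j ∈ C) ∧ (i ∈ C → φ i = s.left i * φ j) ∧
      (j ∈ C → φ j = s.left j * φ i) by
    have := (Potential.one C φ).step hs hC.1 hC.2.1 hC.2.2
    rwa [mul_one] at this
  have hoff : flatOff (s * z) i j ⊆ flatOff z i j := by
    have := flatOff_subset (x := s * z) hs.inv
    rwa [inv_mul_cancel_left] at this
  have hle := Finset.card_le_card hoff
  have hsub : flatOff z i j ⊆ cyclesIn z (idClass Γ) := Finset.filter_subset _ _
  -- If at most one trivial cycle of `s * z` meets `{i, j}`, counting shows that no trivial cycle of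
  -- `z` does, so `C` avoids both letters. Otherwise `i` and `j` lie on two distinct trivial cycles
  -- of `s * z`.
  by_cases hA : flat (s * z) ≤ (flatOff (s * z) i j).card + 1
  · have heq : flatOff z i j = cyclesIn z (idClass Γ) :=
      Finset.eq_of_subset_of_card_le hsub (by unfold flat at *; omega)
    have hi : i ∉ C := fun hi => by
      have := h.mem_flat hi
      rw [← heq] at this
      exact (Finset.mem_filter.1 this).2.1 (self_mem_cycleThrough _ _)
    have hj : j ∉ C := fun hj => by
      have := h.mem_flat hj
      rw [← heq] at this
      exact (Finset.mem_filter.1 this).2.2 (self_mem_cycleThrough _ _)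
    exact ⟨iff_of_false hi hj, fun h => absurd h hi, fun h => absurd h hj⟩
  · have hcov := cyclesIn_subset_flatOff_union (s * z) i j
    have single : ∀ D, ¬ cyclesIn (s * z) (idClass Γ) ⊆ flatOff (s * z) i j ∪ {D} := by
      intro D hD
      have := (Finset.card_le_card hD).trans (Finset.card_union_le _ _)
      rw [Finset.card_singleton] at this
      exact hA this
    have hij : ¬ (s * z).right.SameCycle i j := by
      intro hij
      rw [cycleThrough_eq_iff.2 hij, Finset.pair_eq_singleton] at hcov
      exact single _ hcov
    have hi : loopLabel (s * z) i = 1 := by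
      by_contra hi
      refine single (cycleThrough (s * z).right j) fun D hD => ?_
      have := hcov hD
      simp only [Finset.mem_union, Finset.mem_insert, Finset.mem_singleton] at this ⊢
      rcases this with h | h | h
      · exact Or.inl h
      · exact absurd (FarahatHigman.mem_flat.1 (h ▸ hD)) hi
      · exact Or.inr h
    have hj : loopLabel (s * z) j = 1 := by
      by_contra hj
      refine single (cycleThrough (s * z).right i) fun D hD => ?_
      have := hcov hD
      simp only [Finset.mem_union, Finset.mem_insert, Finset.mem_singleton] at this ⊢
      rcases this with h | h | h
      · exact Or.inl h
      · exact Or.inr h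
      · exact absurd (FarahatHigman.mem_flat.1 (h ▸ hD)) hj
    have hne : i ≠ j := fun h => hij (h ▸ Equiv.Perm.SameCycle.refl _ _)
    -- Since `z` is `s⁻¹ * (s * z)`, it is a join of these two cycles and has a potential `ψ`
    -- compatible with `s`; it remains to pass from `ψ` to `φ`.
    obtain ⟨D, ψ, hψ, hiD, hjD, e1, e2⟩ := exists_potential_join hs.inv hij hi hj
    rw [inv_mul_cancel_left] at hψ
    rw [hs.inv_left.1, ← eq_inv_of_mul_eq_one_left (hs.left_mul hne)] at e1
    rw [hs.inv_left.2, ← eq_inv_of_mul_eq_one_left (hs.mul_left hne)] at e2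
    -- Otherwise `ψ` would give `z` two distinct trivial cycles through `i` and `j`, hence at least
    -- as many trivial cycles as `s * z`.
    have hz : z.right.SameCycle i j := by
      by_contra hz
      have hpair : flatOff z i j ∪ {cycleThrough z.right i, cycleThrough z.right j} ⊆
          cyclesIn z (idClass Γ) := by
        refine Finset.union_subset hsub ?_
        intro E hE
        rcases Finset.mem_insert.1 hE with rfl | hE
        · exact hψ.mem_flat hiD
        · rw [Finset.mem_singleton.1 hE]; exact hψ.mem_flat hjD
      have hcard := Finset.card_le_card hpair
      rw [Finset.card_union_of_disjoint, Finset.card_pair (mt cycleThrough_eq_iff.1 hz)] at hcard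
      · have := (Finset.card_le_card hcov).trans (Finset.card_union_le _ _)
        have h3 : ({cycleThrough (s * z).right i, cycleThrough (s * z).right j} :
          Finset _).card ≤ 2 := Finset.card_le_two
        unfold flat at *
        omega
      · refine Finset.disjoint_left.2 fun E hE hE' => ?_
        obtain ⟨-, ha, hb⟩ := Finset.mem_filter.1 hE
        rcases Finset.mem_insert.1 hE' with rfl | hE'
        · exact ha (self_mem_cycleThrough _ _)
        · rw [Finset.mem_singleton.1 hE'] at hb
          exact hb (self_mem_cycleThrough _ _)
    -- On one cycle of `z` the ratio of values at two letters is the same for all potentials, so the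
    -- relations for `ψ` hold for `φ`.
    exact ⟨⟨fun hiC => (h.transport hψ hiC hiD hz e2).1,
        fun hjC => (h.transport hψ hjC hjD hz.symm e1).1⟩,
      fun hiC => (h.transport hψ (h.transport hψ hiC hiD hz e2).1 hjD hz.symm e1).2,
      fun hjC => (h.transport hψ (h.transport hψ hjC hjD hz.symm e1).1 hiD hz e2).2⟩

/-- In a factorisation `x y` with additive degrees, every trivialisation of `x y`
trivialises `x`. -/
theorem Potential.of_geodesic [Finite Γ] {x y : Wreath Γ n}
    (hxy : elemDegree x + elemDegree y = elemDegree (x * y)) {C : Set (Fin n)} {φ : Fin n → Γ}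
    (h : Potential (x * y) C φ) : Potential x C φ := by
  induction hN : elemDegree x using Nat.strong_induction_on generalizing x with
  | _ N ih =>
    by_cases hx : x = 1
    · subst hx; exact Potential.one C φ
    · obtain ⟨s, i, j, hs, hflat⟩ := exists_step hx
      have h1 := norm_add_flat x
      have h2 := norm_add_flat (s * x)
      have h3 := norm_add_flat (x * y)
      have h4 := norm_add_flat (s * (x * y))
      have h5 := flat_le_step (x := s * (x * y)) hs.inv
      rw [inv_mul_cancel_left] at h5
      have h6 := flat_le_step (x := s * x) hs.inv
      rw [inv_mul_cancel_left] at h6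
      have h7 := norm_mul_le (s * x) y
      rw [mul_assoc] at h7
      -- By subadditivity the degree of `s * x * y` is at most that of `s * x` plus that of `y`,
      -- which is less than that of `x * y`, so `s` creates a trivial cycle. As it changes the
      -- degree by at most one, the factorisation of `s * x * y` is again additive.
      have hsp := h.of_flat_lt hs (by omega)
      have := ih _ (by omega) (x := s * x) (by rw [mul_assoc]; omega)
        (by rw [mul_assoc]; exact hsp.mul h) rfl
      have := hsp.inv.mul this
      rwa [inv_mul_cancel_left] at this

end Geodesics

/-! ### Direct sums, and the existence of elements of every type -/

section DirectSum

variable {Γ : Type*} [Group Γ] {n m a b : ℕ}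

/-- `e` identifies `x` with the restriction of `y` to an invariant set of letters. -/
structure Intertwines (e : Fin n ↪ Fin m) (x : Wreath Γ n) (y : Wreath Γ m) : Prop where
  right_eq : ∀ i, y.right (e i) = e (x.right i)
  left_eq : ∀ i, y.left (e i) = x.left i

theorem Intertwines.one (e : Fin n ↪ Fin m) :
    Intertwines e (1 : Wreath Γ n) (1 : Wreath Γ m) := ⟨fun _ => rfl, fun _ => rfl⟩

theorem Intertwines.mul {e : Fin n ↪ Fin m} {x x' : Wreath Γ n} {y y' : Wreath Γ m}
    (h : Intertwines e x y) (h' : Intertwines e x' y') : Intertwines e (x * x') (y * y') := by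
  refine ⟨fun i => ?_, fun i => ?_⟩
  · simp [h.right_eq, h'.right_eq]
  · have : y.right⁻¹ (e i) = e (x.right⁻¹ i) := by
      rw [Equiv.Perm.inv_eq_iff_eq, h.right_eq]
      simp
    rw [left_mul, left_mul, this, h.left_eq, h'.left_eq]

theorem Intertwines.pow {e : Fin n ↪ Fin m} {x : Wreath Γ n} {y : Wreath Γ m}
    (h : Intertwines e x y) (k : ℕ) : Intertwines e (x ^ k) (y ^ k) := by
  induction k with
  | zero => simpa using Intertwines.one e
  | succ k ih => rw [pow_succ, pow_succ]; exact ih.mul h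

theorem Intertwines.right_pow {e : Fin n ↪ Fin m} {x : Wreath Γ n} {y : Wreath Γ m}
    (h : Intertwines e x y) (k : ℕ) (i : Fin n) : (y.right ^ k) (e i) = e ((x.right ^ k) i) := by
  rw [← FarahatHigman.right_pow, ← FarahatHigman.right_pow, (h.pow k).right_eq]

theorem Intertwines.loopLabel_eq {e : Fin n ↪ Fin m} {x : Wreath Γ n} {y : Wreath Γ m}
    (h : Intertwines e x y) (i : Fin n) : loopLabel y (e i) = loopLabel x i := by
  have hp : Function.minimalPeriod y.right (e i) = Function.minimalPeriod x.right i := by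
    apply Function.minimalPeriod_eq_minimalPeriod_iff.2
    intro k
    simp only [Function.IsPeriodicPt, Function.IsFixedPt, Equiv.Perm.iterate_eq_pow, h.right_pow,
      e.apply_eq_iff_eq]
  rw [loopLabel, hp, (h.pow _).left_eq, loopLabel]

theorem Intertwines.cycleThrough_eq {e : Fin n ↪ Fin m} {x : Wreath Γ n} {y : Wreath Γ m}
    (h : Intertwines e x y) (i : Fin n) :
    cycleThrough y.right (e i) = (cycleThrough x.right i).map e := by
  ext k
  rw [mem_cycleThrough, Finset.mem_map]
  constructor
  · intro hk
    obtain ⟨l, -, -, rfl⟩ := hk.exists_pow_eq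
    exact ⟨(x.right ^ l) i, mem_cycleThrough.2 ⟨l, by rw [zpow_natCast]⟩, (h.right_pow l i).symm⟩
  · rintro ⟨k, hk, rfl⟩
    obtain ⟨l, -, -, rfl⟩ := (mem_cycleThrough.1 hk).exists_pow_eq
    exact ⟨l, by rw [zpow_natCast, h.right_pow]⟩

theorem Intertwines.map_mem_cyclesIn {e : Fin n ↪ Fin m} {x : Wreath Γ n} {y : Wreath Γ m}
    (h : Intertwines e x y) {c : ConjClasses Γ} {C : Finset (Fin n)} (hC : C ∈ cyclesIn x c) :
    C.map e ∈ cyclesIn y c := by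
  obtain ⟨i, rfl⟩ := mem_cycles.1 (mem_cyclesIn.1 hC).1
  rw [← h.cycleThrough_eq, cycleThrough_mem_cyclesIn, h.loopLabel_eq]
  exact cycleThrough_mem_cyclesIn.1 hC

theorem Intertwines.exists_of_mem_cyclesIn {e : Fin n ↪ Fin m} {x : Wreath Γ n} {y : Wreath Γ m}
    (h : Intertwines e x y) {c : ConjClasses Γ} {i : Fin n}
    (hC : cycleThrough y.right (e i) ∈ cyclesIn y c) :
    ∃ C ∈ cyclesIn x c, C.map e = cycleThrough y.right (e i) := by
  refine ⟨_, ?_, (h.cycleThrough_eq i).symm⟩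
  rw [cycleThrough_mem_cyclesIn] at hC ⊢
  rw [← hC, h.loopLabel_eq]

/-- If the letters of `y` split into those of `x` and those of `x'`, the types add up. -/
theorem cycleType_of_intertwines {e : Fin a ↪ Fin n} {e' : Fin b ↪ Fin n} {x : Wreath Γ a}
    {x' : Wreath Γ b} {y : Wreath Γ n} (h : Intertwines e x y) (h' : Intertwines e' x' y)
    (hdisj : ∀ i j, e i ≠ e' j) (hcov : ∀ k, (∃ i, e i = k) ∨ ∃ j, e' j = k)
    (c : ConjClasses Γ) :
    (cycleType y c).1 = (cycleType x c).1 + (cycleType x' c).1 := by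
  classical
  have hu : cyclesIn y c =
      (cyclesIn x c).map ⟨_, Finset.map_injective e⟩ ∪
        (cyclesIn x' c).map ⟨_, Finset.map_injective e'⟩ := by
    ext C
    simp only [Finset.mem_union, Finset.mem_map, Function.Embedding.coeFn_mk]
    constructor
    · intro hC
      obtain ⟨k, rfl⟩ := mem_cycles.1 (mem_cyclesIn.1 hC).1
      rcases hcov k with ⟨i, rfl⟩ | ⟨i, rfl⟩
      · exact Or.inl (h.exists_of_mem_cyclesIn hC)
      · exact Or.inr (h'.exists_of_mem_cyclesIn hC)
    · rintro (⟨C, hC, rfl⟩ | ⟨C, hC, rfl⟩)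
      · exact h.map_mem_cyclesIn hC
      · exact h'.map_mem_cyclesIn hC
  have hd : Disjoint ((cyclesIn x c).map ⟨_, Finset.map_injective e⟩)
      ((cyclesIn x' c).map ⟨_, Finset.map_injective e'⟩) := by
    refine Finset.disjoint_left.2 fun C hC hC' => ?_
    obtain ⟨D, hD, rfl⟩ := Finset.mem_map.1 hC
    obtain ⟨D', -, hDD⟩ := Finset.mem_map.1 hC'
    obtain ⟨i, hi, -⟩ := (mem_cyclesIn.1 hD).2
    have : e i ∈ D'.map e' := by
      change D'.map e' = D.map e at hDD
      rw [hDD]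
      exact Finset.mem_map_of_mem e hi
    obtain ⟨j, -, hj⟩ := Finset.mem_map.1 this
    exact hdisj i j hj.symm
  show (cyclesIn y c).val.map Finset.card = (cyclesIn x c).val.map Finset.card +
    (cyclesIn x' c).val.map Finset.card
  rw [hu, ← Finset.disjUnion_eq_union _ _ hd, Finset.disjUnion_val, Multiset.map_add,
    Finset.map_val, Finset.map_val, Multiset.map_map, Multiset.map_map]
  simp

/-- The element of `Γ_{a+b}` acting as `x` on the first `a` and as `y` on the last `b` letters. -/
def directSum (x : Wreath Γ a) (y : Wreath Γ b) : Wreath Γ (a + b) :=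
  ⟨Fin.append x.left y.left, finSumFinEquiv.permCongr (Equiv.Perm.sumCongr x.right y.right)⟩

theorem directSum_intertwines_left (x : Wreath Γ a) (y : Wreath Γ b) :
    Intertwines (Fin.castAddEmb b) x (directSum x y) := by
  refine ⟨fun i => ?_, fun i => ?_⟩ <;> simp [directSum, Equiv.permCongr_apply]

theorem directSum_intertwines_right (x : Wreath Γ a) (y : Wreath Γ b) :
    Intertwines (Fin.natAddEmb a) y (directSum x y) := by
  refine ⟨fun i => ?_, fun i => ?_⟩ <;> simp [directSum, Equiv.permCongr_apply]

theorem cycleType_directSum (x : Wreath Γ a) (y : Wreath Γ b) (c : ConjClasses Γ) :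
    (cycleType (directSum x y) c).1 = (cycleType x c).1 + (cycleType y c).1 := by
  refine cycleType_of_intertwines (directSum_intertwines_left x y)
    (directSum_intertwines_right x y) (fun i j h => ?_) (fun k => ?_) c
  · have := congrArg Fin.val h
    simp at this
    omega
  · refine Fin.addCases (fun i => Or.inl ⟨i, rfl⟩) (fun i => Or.inr ⟨i, rfl⟩) k

theorem Intertwines.ext {x : Wreath Γ a} {x' : Wreath Γ b} {y z : Wreath Γ (a + b)}
    (h : Intertwines (Fin.castAddEmb b) x y) (h' : Intertwines (Fin.natAddEmb a) x' y)
    (k : Intertwines (Fin.castAddEmb b) x z) (k' : Intertwines (Fin.natAddEmb a) x' z) :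
    y = z := by
  refine SemidirectProduct.ext (funext fun i => ?_) (Equiv.ext fun i => ?_)
  · exact Fin.addCases (fun i => (h.left_eq i).trans (k.left_eq i).symm)
      (fun i => (h'.left_eq i).trans (k'.left_eq i).symm) i
  · exact Fin.addCases (fun i => (h.right_eq i).trans (k.right_eq i).symm)
      (fun i => (h'.right_eq i).trans (k'.right_eq i).symm) i

theorem directSum_mul (x x' : Wreath Γ a) (y y' : Wreath Γ b) :
    directSum (x * x') (y * y') = directSum x y * directSum x' y' :=
  Intertwines.ext (directSum_intertwines_left _ _) (directSum_intertwines_right _ _)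
    ((directSum_intertwines_left _ _).mul (directSum_intertwines_left _ _))
    ((directSum_intertwines_right _ _).mul (directSum_intertwines_right _ _))

theorem directSum_left_injective (y : Wreath Γ b) :
    Function.Injective fun x : Wreath Γ a => directSum x y := by
  intro x x' h
  have h1 := directSum_intertwines_left x y
  have h2 := directSum_intertwines_left x' y
  rw [show directSum x y = directSum x' y from h] at h1
  refine SemidirectProduct.ext (funext fun i => ?_) (Equiv.ext fun i => ?_)
  · exact (h1.left_eq i).symm.trans (h2.left_eq i)
  · exact (Fin.castAddEmb b).injective ((h1.right_eq i).symm.trans (h2.right_eq i))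

/-- The elements that act trivially on the last `b` letters. -/
theorem exists_eq_directSum_one {y : Wreath Γ (a + b)}
    (h : Intertwines (Fin.natAddEmb a) (1 : Wreath Γ b) y) : ∃ x, y = directSum x 1 := by
  have hr : ∀ i, y.right (Fin.natAdd a i) = Fin.natAdd a i := h.right_eq
  have hmaps : Set.MapsTo (finSumFinEquiv.symm.permCongr y.right)
      (Set.range (Sum.inr : Fin b → Fin a ⊕ Fin b)) (Set.range Sum.inr) := by
    rintro _ ⟨i, rfl⟩
    exact ⟨i, by simp [Equiv.permCongr_apply, hr]⟩
  obtain ⟨⟨σ, τ⟩, hστ⟩ := Equiv.Perm.mem_sumCongrHom_range_of_perm_mapsTo_inl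
    ((Equiv.Perm.perm_mapsTo_inl_iff_mapsTo_inr _).2 hmaps)
  refine ⟨⟨fun i => y.left (Fin.castAdd b i), σ⟩, Intertwines.ext (x' := 1) ⟨fun i => ?_, fun i => rfl⟩ h
    (directSum_intertwines_left _ _) (directSum_intertwines_right _ _)⟩
  have := congrArg (fun p => p (Sum.inl i)) hστ
  simp only [Equiv.Perm.sumCongrHom_apply, Equiv.permCongr_apply, Equiv.symm_symm,
    Equiv.Perm.sumCongr_apply, Sum.map_inl, finSumFinEquiv_apply_left] at this
  rw [eq_comm, Equiv.symm_apply_eq] at this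
  exact this

theorem cycleType_one [DecidableEq (ConjClasses Γ)] (c : ConjClasses Γ) :
    (cycleType (1 : Wreath Γ n) c).1 =
      (Finset.univ.filter fun _ : Fin n => c = idClass Γ).val.map fun _ => 1 := by
  have h2 : ∀ i : Fin n, cycleThrough (1 : Wreath Γ n).right i = {i} := by
    intro i
    ext j
    rw [mem_cycleThrough, SemidirectProduct.one_right, Equiv.Perm.sameCycle_one,
      Finset.mem_singleton, eq_comm]
  have h1 : cyclesIn (1 : Wreath Γ n) c = (Finset.univ.filter fun _ : Fin n => c = idClass Γ).map
      ⟨fun i : Fin n => {i}, Finset.singleton_injective⟩ := by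
    have h3 : ∀ i : Fin n, {i} ∈ cyclesIn (1 : Wreath Γ n) c ↔ c = idClass Γ := by
      intro i
      rw [← h2 i, cycleThrough_mem_cyclesIn, eq_comm]
      simp [loopLabel]
    ext C
    simp only [Finset.mem_map, Finset.mem_filter, Finset.mem_univ, true_and,
      Function.Embedding.coeFn_mk]
    constructor
    · intro hC
      obtain ⟨i, rfl⟩ := mem_cycles.1 (mem_cyclesIn.1 hC).1
      rw [h2] at hC ⊢
      exact ⟨i, (h3 i).1 hC, rfl⟩
    · rintro ⟨i, hi, rfl⟩
      exact (h3 i).2 hi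
  show (cyclesIn (1 : Wreath Γ n) c).val.map Finset.card = _
  rw [h1, Finset.map_val, Multiset.map_map]
  simp

/-- Adjoined letters contribute parts equal to one at $c^0$, which lowering turns into zeros and
drops. This invariance is what allows types to be compared across different `n`. -/
theorem modifiedType_directSum_one (x : Wreath Γ a) (b : ℕ) :
    modifiedType (directSum x (1 : Wreath Γ b)) = modifiedType x := by
  classical
  funext c
  apply Subtype.ext
  unfold modifiedType lower
  by_cases hc : c = idClass Γ
  · simp only [if_pos hc, cycleType_directSum, cycleType_one, Multiset.map_add,
      Multiset.filter_add, Multiset.map_map]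
    simp [Multiset.filter_eq_nil, Multiset.mem_replicate]
  · simp only [if_neg hc, cycleType_directSum, cycleType_one]
    simp [hc]

theorem cycleType_one_zero (c : ConjClasses Γ) : (cycleType (1 : Wreath Γ 0) c).1 = 0 := by
  classical
  rw [cycleType_one]
  rfl

/-- The cycle `(1 2 … r)` with cycle-product `g`. -/
theorem exists_cycleType_single [DecidableEq (ConjClasses Γ)] (d : ConjClasses Γ) {r : ℕ}
    (hr : r ≠ 0) :
    ∃ z : Wreath Γ r, ∀ c, (cycleType z c).1 = if c = d then {r} else 0 := by
  classical
  obtain ⟨k, rfl⟩ := Nat.exists_eq_succ_of_ne_zero hr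
  obtain ⟨g, rfl⟩ := d.exists_rep
  let z : Wreath Γ (k + 1) := ⟨Pi.mulSingle 0 g, finRotate (k + 1)⟩
  have hcyc : ∀ i, cycleThrough z.right i = Finset.univ := by
    intro i
    ext j
    simp only [mem_cycleThrough, Finset.mem_univ, iff_true]
    show (finRotate (k + 1)).SameCycle i j
    -- The rotation of a single letter is the identity, which is not a cycle in the sense of
    -- `Equiv.Perm.IsCycle`.
    cases k with
    | zero => exact (Subsingleton.elim (α := Fin 1) i j) ▸ Equiv.Perm.SameCycle.refl _ _
    | succ k =>
      have hs : ∀ i, finRotate (k + 2) i ≠ i := fun i =>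
        Equiv.Perm.mem_support.1 (by rw [support_finRotate]; exact Finset.mem_univ i)
      exact isCycle_finRotate.sameCycle (hs i) (hs j)
  have hlab : cycleProd z 0 = g := by
    unfold cycleProd
    have hp : 0 < Function.minimalPeriod z.right 0 := Function.minimalPeriod_pos_of_mem_periodicPts
        (Function.Injective.mem_periodicPts z.right.injective 0)
    obtain ⟨p, hp'⟩ := Nat.exists_eq_succ_of_ne_zero hp.ne'
    -- Only the exponent 0, last in the reversed list, sees the label `g`: the orbit does not return
    -- to the letter 0 before a full period.
    rw [hp', List.range_succ_eq_map, List.reverse_cons, List.map_append, List.prod_append,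
      List.prod_eq_one]
    · rw [one_mul]
      show Pi.mulSingle (M := fun _ : Fin (k + 1) => Γ) 0 g ((finRotate (k + 1) ^ 0) 0) * 1 = g
      rw [mul_one]
      exact Pi.mulSingle_eq_same (M := fun _ : Fin (k + 1) => Γ) 0 g
    · intro x hx
      simp only [List.mem_map, List.mem_reverse, List.mem_range] at hx
      obtain ⟨_, ⟨l, hl, rfl⟩, rfl⟩ := hx
      refine Pi.mulSingle_eq_of_ne (M := fun _ : Fin (k + 1) => Γ) (fun h => ?_) g
      rw [← Equiv.Perm.iterate_eq_pow] at h
      have := Function.IsPeriodicPt.minimalPeriod_le (f := z.right) (x := 0) (n := l + 1)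
        (Nat.succ_pos l) h
      omega
  refine ⟨z, fun c => ?_⟩
  have hmem : Finset.univ ∈ cyclesIn z c ↔ c = ConjClasses.mk g := by
    rw [← hcyc 0, cycleThrough_mem_cyclesIn, ← mk_cycleProd, hlab, eq_comm]
  have hsub : cyclesIn z c ⊆ {Finset.univ} := by
    intro C hC
    obtain ⟨i, rfl⟩ := mem_cycles.1 (mem_cyclesIn.1 hC).1
    rw [hcyc]
    exact Finset.mem_singleton_self _
  show (cyclesIn z c).val.map Finset.card = _
  split_ifs with h
  · rw [show cyclesIn z c = {Finset.univ} from
      hsub.antisymm (Finset.singleton_subset_iff.2 (hmem.2 h))]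
    simp
  · rw [show cyclesIn z c = ∅ from ?_]
    · rfl
    · refine Finset.eq_empty_of_forall_notMem fun C hC => h (hmem.1 ?_)
      rwa [← Finset.mem_singleton.1 (hsub hC)]

theorem exists_cycleType_eq [Finite Γ] (ρ : PartFun Γ) :
    ∃ (n : ℕ) (z : Wreath Γ n), cycleType z = ρ := by
  classical
  have : Fintype (ConjClasses Γ) := Fintype.ofFinite _
  have h1 : ∀ (d : ConjClasses Γ) (p : Multiset ℕ), 0 ∉ p →
      ∃ (n : ℕ) (z : Wreath Γ n), ∀ c, (cycleType z c).1 = if c = d then p else 0 := by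
    intro d p
    induction p using Multiset.induction with
    | empty => exact fun _ => ⟨0, 1, fun c => by rw [cycleType_one_zero, ite_self]⟩
    | cons r p ih =>
      intro hp
      rw [Multiset.mem_cons, not_or] at hp
      obtain ⟨n, z, hz⟩ := ih hp.2
      obtain ⟨w, hw⟩ := exists_cycleType_single d (Ne.symm hp.1)
      refine ⟨_, directSum w z, fun c => ?_⟩
      rw [cycleType_directSum, hz, hw]
      split_ifs
      · rfl
      · rfl
  have h2 : ∀ S : Finset (ConjClasses Γ), ∃ (n : ℕ) (z : Wreath Γ n),
      ∀ c, (cycleType z c).1 = if c ∈ S then (ρ c).1 else 0 := by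
    intro S
    induction S using Finset.induction_on with
    | empty => exact ⟨0, 1, fun c => by simp [cycleType_one_zero]⟩
    | insert d S hd ih =>
      obtain ⟨n, z, hz⟩ := ih
      obtain ⟨m, w, hw⟩ := h1 d (ρ d).1 (ρ d).2
      refine ⟨_, directSum w z, fun c => ?_⟩
      rw [cycleType_directSum, hz, hw]
      by_cases hc : c = d
      · subst hc; simp [hd]
      · simp [hc]
  obtain ⟨n, z, hz⟩ := h2 Finset.univ
  exact ⟨n, z, funext fun c => Subtype.ext (by simpa using hz c)⟩

theorem exists_modifiedType_eq [Finite Γ] (ρ : PartFun Γ) :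
    ∃ (n : ℕ) (z : Wreath Γ n), modifiedType z = ρ := by
  classical
  -- Raising the parts at $c^0$ by one is a section of `lower`; all parts of `ρ` are positive, so
  -- nothing is dropped on the way back.
  obtain ⟨n, z, hz⟩ := exists_cycleType_eq (Γ := Γ) fun c =>
    if c = idClass Γ then ⟨(ρ c).1.map (· + 1), by simp⟩ else ρ c
  refine ⟨n, z, funext fun c => Subtype.ext ?_⟩
  unfold modifiedType lower
  rw [hz]
  by_cases hc : c = idClass Γ
  · simp only [if_pos hc, Multiset.map_map]
    simp only [Function.comp_def, Nat.add_sub_cancel, Multiset.map_id']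
    exact Multiset.filter_eq_self.2 fun r hr h => (ρ c).2 (h ▸ hr)
  · simp only [if_neg hc]

end DirectSum

/-! ### Equal modified types in $\Gamma_n$ imply conjugacy -/

section Conjugacy

variable {Γ : Type*} [Group Γ] {n : ℕ}

/-- One more turn around the cycle multiplies the label accumulated from `i` by the loop label on
the right. -/
theorem pow_add_period_left (x : Wreath Γ n) (i : Fin n) (k : ℕ) :
    (x ^ (k + Function.minimalPeriod x.right i)).left
        ((x.right ^ (k + Function.minimalPeriod x.right i)) i) =
      (x ^ k).left ((x.right ^ k) i) * loopLabel x i := by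
  rw [pow_add x.right, Equiv.Perm.mul_apply, pow_period, pow_add, left_mul, right_pow,
    show (x.right ^ k)⁻¹ ((x.right ^ k) i) = i from (x.right ^ k).symm_apply_apply i, loopLabel]

theorem pow_succ_left (x : Wreath Γ n) (i : Fin n) (k : ℕ) :
    (x ^ (k + 1)).left ((x.right ^ (k + 1)) i) =
      x.left (x.right ((x.right ^ k) i)) * (x ^ k).left ((x.right ^ k) i) := by
  rw [pow_succ' x.right, Equiv.Perm.mul_apply, pow_succ', left_mul]
  simp

theorem mod_period_eq {σ : Equiv.Perm (Fin n)} {i : Fin n} {a b : ℕ}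
    (h : (σ ^ a) i = (σ ^ b) i) :
    a % Function.minimalPeriod σ i = b % Function.minimalPeriod σ i := by
  rw [← Equiv.Perm.iterate_eq_pow, ← Equiv.Perm.iterate_eq_pow] at h
  have hpp : 0 < Function.minimalPeriod σ i := Function.minimalPeriod_pos_of_mem_periodicPts
    (Function.Injective.mem_periodicPts σ.injective i)
  refine Function.iterate_injOn_Iio_minimalPeriod (f := σ) (x := i)
    (Nat.mod_lt _ hpp) (Nat.mod_lt _ hpp) ?_
  show σ^[a % _] i = σ^[b % _] i
  rw [Function.iterate_mod_minimalPeriod_eq, Function.iterate_mod_minimalPeriod_eq, h]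

theorem pow_eq_pow_of_mod {σ : Equiv.Perm (Fin n)} {i : Fin n} {a b : ℕ}
    (h : a % Function.minimalPeriod σ i = b % Function.minimalPeriod σ i) :
    (σ ^ a) i = (σ ^ b) i := by
  rw [← Equiv.Perm.iterate_eq_pow, ← Equiv.Perm.iterate_eq_pow,
    ← Function.iterate_mod_minimalPeriod_eq, h, Function.iterate_mod_minimalPeriod_eq]

theorem card_cycleThrough (σ : Equiv.Perm (Fin n)) (i : Fin n) :
    (cycleThrough σ i).card = Function.minimalPeriod σ i := by
  classical
  have h : cycleThrough σ i =
      (Finset.range (Function.minimalPeriod σ i)).image fun k => (σ ^ k) i := by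
    ext j
    rw [mem_cycleThrough, Finset.mem_image]
    constructor
    · intro hj
      obtain ⟨m, -, -, rfl⟩ := hj.exists_pow_eq
      refine ⟨m % _, Finset.mem_range.2 (Nat.mod_lt _ ?_), pow_eq_pow_of_mod (Nat.mod_mod _ _)⟩
      exact Function.minimalPeriod_pos_of_mem_periodicPts
        (Function.Injective.mem_periodicPts σ.injective i)
    · rintro ⟨m, -, rfl⟩
      exact ⟨m, by rw [zpow_natCast]⟩
  rw [h, Finset.card_image_of_injOn, Finset.card_range]
  intro a ha b hb hab
  have := mod_period_eq hab
  rwa [Nat.mod_eq_of_lt (Finset.mem_range.1 ha), Nat.mod_eq_of_lt (Finset.mem_range.1 hb)] at this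

/-- A letter of each cycle. -/
noncomputable def cycleRep {σ : Equiv.Perm (Fin n)} (C : {C // C ∈ cycles σ}) : Fin n :=
  (mem_cycles.1 C.2).choose

theorem cycleThrough_cycleRep {σ : Equiv.Perm (Fin n)} (C : {C // C ∈ cycles σ}) :
    cycleThrough σ (cycleRep C) = C.1 := (mem_cycles.1 C.2).choose_spec

theorem mem_cyclesIn_iff_cycleRep {x : Wreath Γ n} (C : {C // C ∈ cycles x.right})
    (c : ConjClasses Γ) :
    C.1 ∈ cyclesIn x c ↔ ConjClasses.mk (loopLabel x (cycleRep C)) = c := by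
  rw [← cycleThrough_cycleRep, cycleThrough_mem_cyclesIn]

-- The multiplicities in the type count the cycles with a given class and length, so equal types
-- allow the cycles to be matched fibre by fibre.
open scoped Classical in
theorem card_cycle_fiber (x : Wreath Γ n) (q : ConjClasses Γ × ℕ) :
    Fintype.card {C : {C // C ∈ cycles x.right} //
      (ConjClasses.mk (loopLabel x (cycleRep C)), C.1.card) = q} =
      (cycleType x q.1).1.count q.2 := by
  obtain ⟨c, r⟩ := q
  have e : {C : {C // C ∈ cycles x.right} //
      (ConjClasses.mk (loopLabel x (cycleRep C)), C.1.card) = (c, r)} ≃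
      {C // C ∈ (cyclesIn x c).filter fun C => r = C.card} :=
    { toFun := fun C => ⟨C.1.1, Finset.mem_filter.2
        ⟨(mem_cyclesIn_iff_cycleRep _ _).2 (Prod.ext_iff.1 C.2).1, (Prod.ext_iff.1 C.2).2.symm⟩⟩
      invFun := fun C => ⟨⟨C.1, (mem_cyclesIn.1 (Finset.mem_filter.1 C.2).1).1⟩,
        Prod.ext ((mem_cyclesIn_iff_cycleRep _ _).1 (Finset.mem_filter.1 C.2).1)
          (Finset.mem_filter.1 C.2).2.symm⟩
      left_inv := fun _ => rfl
      right_inv := fun _ => rfl }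
  rw [Fintype.card_congr e, Fintype.card_coe]
  show _ = ((cyclesIn x c).val.map Finset.card).count r
  rw [Multiset.count_map]
  rfl

/-- Elements of equal type have matching cycles. -/
theorem exists_cycle_equiv {x y : Wreath Γ n} (h : cycleType x = cycleType y) :
    ∃ E : {C // C ∈ cycles x.right} ≃ {C // C ∈ cycles y.right}, ∀ C,
      IsConj (loopLabel x (cycleRep C)) (loopLabel y (cycleRep (E C))) ∧
      Function.minimalPeriod x.right (cycleRep C) =
        Function.minimalPeriod y.right (cycleRep (E C)) := by
  classical
  have hfib : ∀ q : ConjClasses Γ × ℕ, Nonempty ({C : {C // C ∈ cycles x.right} //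
      (ConjClasses.mk (loopLabel x (cycleRep C)), C.1.card) = q} ≃
      {C : {C // C ∈ cycles y.right} //
      (ConjClasses.mk (loopLabel y (cycleRep C)), C.1.card) = q}) := fun q =>
    ⟨Fintype.equivOfCardEq (by rw [card_cycle_fiber, card_cycle_fiber, h])⟩
  refine ⟨Equiv.ofFiberEquiv fun q => (hfib q).some, fun C => ?_⟩
  have := Equiv.ofFiberEquiv_map (fun q => (hfib q).some) C
  obtain ⟨h1, h2⟩ := Prod.ext_iff.1 this
  refine ⟨(ConjClasses.mk_eq_mk_iff_isConj.1 h1).symm, ?_⟩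
  rw [← card_cycleThrough, ← card_cycleThrough, cycleThrough_cycleRep, cycleThrough_cycleRep]
  exact h2.symm

/-- Match the cycles, choose base letters and elements conjugating the loop labels there, then
propagate along each cycle: the letter reached after `k` steps of `x` goes to the letter reached
after `k` steps of `y`. -/
theorem isConj_of_cycleType_eq {x y : Wreath Γ n} (h : cycleType x = cycleType y) :
    IsConj x y := by
  obtain ⟨E, hE⟩ := exists_cycle_equiv h
  have hA : ∀ C, ∃ A : Γ, A * loopLabel x (cycleRep C) * A⁻¹ = loopLabel y (cycleRep (E C)) :=
    fun C => isConj_iff.1 (hE C).1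
  choose A hA using hA
  let cyc : Fin n → {C // C ∈ cycles x.right} := fun l =>
    ⟨cycleThrough x.right l, mem_cycles.2 ⟨l, rfl⟩⟩
  have hcyc : ∀ l, cyc (x.right l) = cyc l := fun l =>
    Subtype.ext (cycleThrough_eq_iff.2 (Equiv.Perm.sameCycle_apply_left.2
      (Equiv.Perm.SameCycle.refl _ _)))
  have hex : ∀ l, ∃ k : ℕ, (x.right ^ k) (cycleRep (cyc l)) = l := by
    intro l
    have hl : x.right.SameCycle (cycleRep (cyc l)) l :=
      cycleThrough_eq_iff.1 (cycleThrough_cycleRep (cyc l))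
    obtain ⟨k, -, -, hk⟩ := hl.exists_pow_eq
    exact ⟨k, hk⟩
  choose k hk using hex
  -- The label that a conjugating element must carry after `k` steps, given its value `A C` at the
  -- base letter.
  let W : {C // C ∈ cycles x.right} → ℕ → Γ := fun C k =>
    (y ^ k).left ((y.right ^ k) (cycleRep (E C))) * A C *
      ((x ^ k).left ((x.right ^ k) (cycleRep C)))⁻¹
  have hW : ∀ C, Function.Periodic (W C) (Function.minimalPeriod x.right (cycleRep C)) := by
    intro C k
    simp only [W]
    rw [pow_add_period_left, (hE C).2, pow_add_period_left, ← hA]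
    group
  have hstep : ∀ l, k (x.right l) % Function.minimalPeriod x.right (cycleRep (cyc l)) =
      (k l + 1) % Function.minimalPeriod x.right (cycleRep (cyc l)) := by
    intro l
    apply mod_period_eq
    rw [pow_succ', Equiv.Perm.mul_apply, hk, ← hcyc, hk]
  -- The chosen exponents `k` are determined only modulo the period. This is harmless because `A C`
  -- conjugates one loop label to the other, which makes `W C` periodic.
  have hW' : ∀ l, W (cyc l) (k (x.right l)) = W (cyc l) (k l + 1) := by
    intro l
    rw [← (hW _).map_mod_nat, hstep, (hW _).map_mod_nat]
  let t : Fin n → Fin n := fun l => (y.right ^ k l) (cycleRep (E (cyc l)))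
  have ht : ∀ l, t (x.right l) = y.right (t l) := by
    intro l
    simp only [t]
    rw [hcyc, ← Equiv.Perm.mul_apply, ← pow_succ']
    refine pow_eq_pow_of_mod ?_
    rw [← (hE _).2]
    exact hstep l
  have hinj : Function.Injective t := by
    intro l l' hll
    have h1 : ∀ l, y.right.SameCycle (cycleRep (E (cyc l))) (t l) := fun l =>
      ⟨k l, by rw [zpow_natCast]⟩
    have h2 : E (cyc l) = E (cyc l') := by
      apply Subtype.ext
      rw [← cycleThrough_cycleRep, ← cycleThrough_cycleRep, cycleThrough_eq_iff]
      exact (h1 l).trans (hll ▸ (h1 l').symm)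
    have h3 := E.injective h2
    simp only [t] at hll
    rw [h3] at hll
    have h4 := mod_period_eq hll
    rw [← (hE _).2] at h4
    rw [← hk l, ← hk l', h3]
    exact pow_eq_pow_of_mod h4
  let τ : Equiv.Perm (Fin n) := Equiv.ofBijective t hinj.bijective_of_finite
  have hτ : ∀ l, τ l = t l := fun _ => rfl
  let z : Wreath Γ n := ⟨fun l => W (cyc (τ.symm l)) (k (τ.symm l)), τ⟩
  have hz : z * x = y * z := by
    refine SemidirectProduct.ext (funext fun l => ?_) (Equiv.ext fun l => ?_)
    · obtain ⟨l, rfl⟩ := τ.surjective l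
      obtain ⟨l, rfl⟩ := x.right.surjective l
      have e1 : z.right⁻¹ (τ (x.right l)) = x.right l := τ.symm_apply_apply _
      have e2 : y.right⁻¹ (τ (x.right l)) = τ l := by
        rw [Equiv.Perm.inv_eq_iff_eq, hτ, hτ, ht]
      rw [left_mul, left_mul, e1, e2]
      have hk' : (x.right ^ k l) (cycleRep (cyc l)) = l := hk l
      have e3 : y.right ((y.right ^ k l) (cycleRep (E (cyc l)))) = τ (x.right l) := by
        rw [hτ, ht]
      simp only [z, Equiv.symm_apply_apply, hcyc, hW']
      simp only [W, pow_succ_left, hk', e3]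
      group
    · show τ (x.right l) = y.right (τ l)
      rw [hτ, hτ, ht]
  exact isConj_iff.2 ⟨z, by rw [hz, mul_inv_cancel_right]⟩

theorem card_cycleType_id (x : Wreath Γ n) : (cycleType x (idClass Γ)).1.card = flat x :=
  Multiset.card_map Finset.card (cyclesIn x (idClass Γ)).val

/-- Lowering and dropping zeros forgets only how many parts were equal to one, and this is recovered
from the total number of parts. -/
theorem pred_map_eq (P : Multiset ℕ) (hP : 0 ∉ P) :
    P = (((P.map fun r => r - 1).filter fun r => r ≠ 0) + Multiset.replicate
      (P.card - ((P.map fun r => r - 1).filter fun r => r ≠ 0).card) 0).map (· + 1) := by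
  have h1 := Multiset.filter_add_not (fun r => r ≠ 0) (P.map fun r => r - 1)
  have h2 : (P.map fun r => r - 1).filter (fun r => ¬ r ≠ 0) = Multiset.replicate
      ((P.map fun r => r - 1).filter fun r => ¬ r ≠ 0).card 0 :=
    Multiset.eq_replicate_card.2 fun r hr => not_not.1 (Multiset.mem_filter.1 hr).2
  have h3 := congrArg Multiset.card h1
  rw [Multiset.card_add, Multiset.card_map] at h3
  rw [← h3, Nat.add_sub_cancel_left, ← h2, h1, Multiset.map_map]
  conv_lhs => rw [← Multiset.map_id P]
  refine Multiset.map_congr rfl fun r hr => ?_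
  have : r ≠ 0 := fun h => hP (h ▸ hr)
  simp only [id, Function.comp]
  omega

/-- The missing number of parts at $c^0$ is `flat`, equal to `n` minus the degree. Here it is
essential that both elements lie in the same $\Gamma_n$. -/
theorem cycleType_eq_of_modifiedType_eq [Finite Γ] {x y : Wreath Γ n}
    (h : modifiedType x = modifiedType y) : cycleType x = cycleType y := by
  classical
  have hf : flat x = flat y := by
    have h1 := norm_add_flat x
    have h2 := norm_add_flat y
    have h3 : elemDegree x = elemDegree y := by rw [elemDegree, h, elemDegree]
    omega
  funext c
  have hc := congrFun h c
  unfold modifiedType lower at hc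
  by_cases hcid : c = idClass Γ
  · simp only [if_pos hcid, Subtype.mk.injEq] at hc
    subst hcid
    apply Subtype.ext
    rw [pred_map_eq _ (cycleType x _).2, pred_map_eq _ (cycleType y _).2, hc, card_cycleType_id,
      card_cycleType_id, hf]
  · simpa only [if_neg hcid] using hc

theorem isConj_of_modifiedType_eq [Finite Γ] {x y : Wreath Γ n}
    (h : modifiedType x = modifiedType y) : IsConj x y :=
  isConj_of_cycleType_eq (cycleType_eq_of_modifiedType_eq h)

end Conjugacy

/-! ### Coefficients of symbols in the associated graded ring -/

section Coefficients

variable {Γ : Type*} [Group Γ] {n : ℕ}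

theorem elemDegree_eq_of_modifiedType {ρ : PartFun Γ} {z : Wreath Γ n} (h : modifiedType z = ρ) :
    elemDegree z = degree ρ := by rw [elemDegree, h]

theorem coeff_eq_of_isConj (f : ClassAlg Γ n) {x y : Wreath Γ n} (h : IsConj x y) :
    f.1.coeff x = f.1.coeff y := by
  obtain ⟨z, rfl⟩ := isConj_iff.1 h
  have h1 := Subring.mem_center_iff.1 f.2 (MonoidAlgebra.single z 1)
  have h2 := congrArg (fun g => MonoidAlgebra.coeff g (z * x)) h1
  simp only [MonoidAlgebra.coeff_single_mul_apply, MonoidAlgebra.coeff_mul_single_apply] at h2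
  simpa using h2

/-- The coefficient at `z` of a symbol of degree `‖z‖`. -/
noncomputable def pieceEval (z : Wreath Γ n) :
    GrPiece (fil Γ n) (filLT Γ n) (elemDegree z) →+ ℤ :=
  QuotientAddGroup.lift _
    (AddMonoidHom.mk' (fun f : fil Γ n (elemDegree z) => f.1.1.coeff z) fun _ _ => rfl)
    fun f hf => by
      by_contra h
      exact lt_irrefl _ (AddSubgroup.mem_addSubgroupOf.1 hf z h)

theorem pieceEval_symb (z : Wreath Γ n) (f : fil Γ n (elemDegree z)) :
    pieceEval z (symb (fil Γ n) (filLT Γ n) _ f) = f.1.1.coeff z := rfl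

variable [Finite Γ]

open scoped Classical in
theorem classSum_coeff (ρ : PartFun Γ) (z : Wreath Γ n) :
    (classSum n ρ).coeff z = if modifiedType z = ρ then 1 else 0 := by
  rw [classSum, MonoidAlgebra.coeff_sum, Finsupp.finsetSum_apply]
  simp [MonoidAlgebra.coeff_single, Finsupp.single_apply, Finset.sum_ite_eq']

theorem coeff_mul_eq_sum (f g : MonoidAlgebra ℤ (Wreath Γ n)) (z : Wreath Γ n) :
    (f * g).coeff z = ∑ x, f.coeff x * g.coeff (x⁻¹ * z) := by
  rw [MonoidAlgebra.coeff_mul_apply_left, Finsupp.sum_fintype]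
  simp

/-- The coefficient at `z` of the component of degree `‖z‖`. -/
noncomputable def grEval (z : Wreath Γ n) : GrRing Γ n →+ ℤ :=
  (pieceEval z).comp (DFinsupp.evalAddMonoidHom (elemDegree z))

theorem grEval_apply (z : Wreath Γ n) (a : GrRing Γ n) :
    grEval z a = pieceEval z (a (elemDegree z)) := rfl

theorem grEval_of_symb (z : Wreath Γ n) (k : ℕ) (f : fil Γ n k) :
    grEval z (DirectSum.of (GrPiece (fil Γ n) (filLT Γ n)) k (symb _ _ k f)) =
      if elemDegree z = k then f.1.1.coeff z else 0 := by
  rw [grEval_apply]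
  split_ifs with h
  · subst h
    rw [DirectSum.of_eq_same, pieceEval_symb]
  · rw [DirectSum.of_eq_of_ne _ _ _ h, map_zero]

open scoped Classical in
theorem grEval_grK (z : Wreath Γ n) (ρ : PartFun Γ) :
    grEval z (grK n ρ) = if modifiedType z = ρ then 1 else 0 := by
  rw [grK, grEval_of_symb]
  show (if _ then (classSum n ρ).coeff z else 0) = _
  rw [classSum_coeff]
  by_cases h : modifiedType z = ρ
  · rw [if_pos h, if_pos (elemDegree_eq_of_modifiedType h)]
  · rw [if_neg h, ite_self]

/-- A class function in $F_k$ that vanishes on all elements of degree exactly `k` lies in $F_{<k}$,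
so its symbol is zero. Later identities in the graded ring are checked on coefficients in this way.
-/
theorem grEval_ext {a b : GrRing Γ n} (h : ∀ z, grEval z a = grEval z b) : a = b := by
  rw [← sub_eq_zero]
  have h0 : ∀ z, grEval z (a - b) = 0 := fun z => by rw [map_sub, h, sub_self]
  refine DFinsupp.ext fun k => ?_
  obtain ⟨f, hf⟩ := symb_surjective (F := fil Γ n) (Flt := filLT Γ n) k ((a - b) k)
  show (a - b) k = 0
  rw [← hf]
  refine symb_eq_zero.2 fun z hz => lt_of_le_of_ne (f.2 z hz) fun hk => hz ?_
  subst hk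
  have := h0 z
  rwa [grEval_apply, ← hf, pieceEval_symb] at this

theorem grEval_of (z : Wreath Γ n) (k : ℕ) (a : GrRing Γ n) :
    grEval z (DirectSum.of (GrPiece (fil Γ n) (filLT Γ n)) k (a k)) =
      if elemDegree z = k then grEval z a else 0 := by
  rw [grEval_apply]
  split_ifs with h
  · subst h
    rw [DirectSum.of_eq_same, grEval_apply]
  · rw [DirectSum.of_eq_of_ne _ _ _ h, map_zero]

theorem grEval_eq_of_modifiedType_eq {x y : Wreath Γ n} (h : modifiedType x = modifiedType y)
    (a : GrRing Γ n) : grEval x a = grEval y a := by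
  have hd : elemDegree x = elemDegree y := by rw [elemDegree, h, elemDegree]
  induction a using DirectSum.induction_on with
  | zero => simp
  | of k a =>
    obtain ⟨f, rfl⟩ := symb_surjective k a
    rw [grEval_of_symb, grEval_of_symb, hd, coeff_eq_of_isConj _ (isConj_of_modifiedType_eq h)]
  | add a b ha hb => rw [map_add, map_add, ha, hb]

/-- Passing to symbols discards the factorisations of `z` whose degrees do not add up. This is where
the graded ring is better behaved than the class algebra. -/
theorem grEval_mul (z : Wreath Γ n) (a b : GrRing Γ n) :
    grEval z (a * b) = ∑ x, if elemDegree x + elemDegree (x⁻¹ * z) = elemDegree z then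
      grEval x a * grEval (x⁻¹ * z) b else 0 := by
  induction a using DirectSum.induction_on with
  | zero => simp
  | add a a' ha ha' =>
    rw [add_mul, map_add, ha, ha', ← Finset.sum_add_distrib]
    refine Finset.sum_congr rfl fun x _ => ?_
    split_ifs
    · rw [map_add, add_mul]
    · rfl
  | of i a =>
    induction b using DirectSum.induction_on with
    | zero => simp
    | add b b' hb hb' =>
      rw [mul_add, map_add, hb, hb', ← Finset.sum_add_distrib]
      refine Finset.sum_congr rfl fun x _ => ?_
      split_ifs
      · rw [map_add, mul_add]
      · rfl
    | of j b =>
      obtain ⟨f, rfl⟩ := symb_surjective i a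
      obtain ⟨g, rfl⟩ := symb_surjective j b
      rw [DirectSum.of_mul_of]
      have : GradedMonoid.GMul.mul (symb (fil Γ n) (filLT Γ n) i f) (symb _ _ j g) =
        symb (fil Γ n) (filLT Γ n) (i + j) ⟨f * g, SetLike.GradedMul.mul_mem f.2 g.2⟩ := rfl
      rw [this, grEval_of_symb]
      show (if _ then (f.1.1 * g.1.1).coeff z else 0) = _
      rw [coeff_mul_eq_sum]
      simp only [grEval_of_symb]
      split_ifs with hz
      · refine Finset.sum_congr rfl fun x _ => ?_
        by_cases hf : f.1.1.coeff x = 0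
        · simp [hf]
        by_cases hg : g.1.1.coeff (x⁻¹ * z) = 0
        · simp [hg]
        -- The factors have degrees at most `i` and `j`, while subadditivity bounds their sum below
        -- by `i + j`; both bounds are therefore attained.
        have h1 := f.2 x hf
        have h2 := g.2 _ hg
        have h3 := norm_mul_le x (x⁻¹ * z)
        rw [mul_inv_cancel_left] at h3
        rw [if_pos (by omega), if_pos (by omega), if_pos (by omega)]
      · refine (Finset.sum_eq_zero fun x _ => ?_).symm
        split_ifs with h1 h2 h3
        · omega
        all_goals simp

theorem grEval_one (z : Wreath Γ n) [Decidable (z = 1)] :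
    grEval z (1 : GrRing Γ n) = if z = 1 then 1 else 0 := by
  classical
  have h : (1 : GrRing Γ n) = DirectSum.of (GrPiece (fil Γ n) (filLT Γ n)) 0
    (symb _ _ 0 ⟨1, SetLike.GradedOne.one_mem⟩) := rfl
  rw [h, grEval_of_symb]
  show (if _ then (MonoidAlgebra.single (1 : Wreath Γ n) (1 : ℤ)).coeff z else 0) = _
  rw [MonoidAlgebra.coeff_single, Finsupp.single_apply]
  by_cases hz : z = 1
  · rw [if_pos (hz ▸ norm_one), if_pos hz.symm, if_pos hz]
  · rw [if_neg (Ne.symm hz), ite_self, if_neg hz]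

open scoped Classical in
theorem grEval_sum (c : PartFun Γ → ℤ) (z : Wreath Γ n) :
    grEval z (∑ ρ ∈ Finset.univ.image (modifiedType : Wreath Γ n → _), c ρ • grK n ρ) =
      c (modifiedType z) := by
  simp only [map_sum, map_zsmul, grEval_grK]
  simp

/-- Used to define elements of the graded ring by prescribing their coefficients. -/
theorem exists_grEval_eq (f : Wreath Γ n → ℤ) (hf : f.FactorsThrough modifiedType) :
    ∃ a : GrRing Γ n, ∀ z, grEval z a = f z :=
  ⟨_, fun z => (grEval_sum (Function.extend modifiedType f 0) z).trans (hf.extend_apply _ z)⟩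

open scoped Classical in
/-- The `K_ρ(n)` span `𝒢_Γ(n)`. -/
theorem eq_sum_grK (a : GrRing Γ n) :
    a = ∑ ρ ∈ Finset.univ.image (modifiedType : Wreath Γ n → _),
      (Function.extend modifiedType (fun z : Wreath Γ n => grEval z a) 0 ρ) • grK n ρ :=
  grEval_ext fun z => by
    rw [grEval_sum]
    have : (fun z : Wreath Γ n => grEval z a).FactorsThrough modifiedType :=
      fun _ _ h => grEval_eq_of_modifiedType_eq h a
    exact (this.extend_apply 0 z).symm

end Coefficients

/-! ### Independence of the top-degree coefficients from `n` -/

section Stability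

variable {Γ : Type*} [Group Γ] {n a b : ℕ}

theorem directSum_one_inv_mul (x z : Wreath Γ a) :
    (directSum x (1 : Wreath Γ b))⁻¹ * directSum z 1 = directSum (x⁻¹ * z) 1 := by
  rw [inv_mul_eq_iff_eq_mul, ← directSum_mul, mul_inv_cancel_left, mul_one]

variable [Finite Γ]

open scoped Classical in
theorem classSum_mul_coeff (l m : PartFun Γ) (z : Wreath Γ n) :
    (classSum n l * classSum n m).coeff z =
      (Finset.univ.filter fun x => modifiedType x = l ∧ modifiedType (x⁻¹ * z) = m).card := by
  rw [coeff_mul_eq_sum]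
  simp only [classSum_coeff, ite_zero_mul_ite_zero, mul_one, Finset.sum_boole]

/-- The hypothesis on degrees makes every counted factorisation additive, so its factors act
trivially on the adjoined letters. The factorisations of `directSum z 1` are thus the direct sums of
those of `z` with 1. -/
theorem coeff_directSum_one (l m : PartFun Γ) (z : Wreath Γ a)
    (hd : elemDegree z = degree l + degree m) :
    (classSum (a + b) l * classSum (a + b) m).coeff (directSum z 1) =
      (classSum a l * classSum a m).coeff z := by
  classical
  rw [classSum_mul_coeff, classSum_mul_coeff, Nat.cast_inj, eq_comm]
  refine Finset.card_bij (fun x _ => directSum x 1) (fun x hx => ?_)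
    (fun x _ y _ h => directSum_left_injective 1 h) fun y hy => ?_
  · rw [Finset.mem_filter] at hx ⊢
    rw [directSum_one_inv_mul, modifiedType_directSum_one, modifiedType_directSum_one]
    exact ⟨Finset.mem_univ _, hx.2⟩
  · obtain ⟨-, h1, h2⟩ := Finset.mem_filter.1 hy
    have hgeo : elemDegree y + elemDegree (y⁻¹ * directSum z 1) =
        elemDegree (y * (y⁻¹ * directSum z (1 : Wreath Γ b))) := by
      rw [mul_inv_cancel_left, elemDegree_eq_of_modifiedType h1, elemDegree_eq_of_modifiedType h2,
        ← hd, elemDegree, elemDegree, modifiedType_directSum_one]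
    -- On a singleton the constant potential 1 says precisely that the letter is fixed with label 1.
    -- The product has this property, and the left factor inherits it.
    have hpot : ∀ i : Fin b, Potential y {Fin.natAdd a i} fun _ => 1 := by
      intro i
      refine Potential.of_geodesic hgeo ?_
      rw [mul_inv_cancel_left]
      rintro _ rfl
      have h := directSum_intertwines_right z (1 : Wreath Γ b)
      have hr : (directSum z (1 : Wreath Γ b)).right (Fin.natAdd a i) = Fin.natAdd a i :=
        h.right_eq i
      have hl : (directSum z (1 : Wreath Γ b)).left (Fin.natAdd a i) = 1 := h.left_eq i
      rw [hr, hl, mul_one]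
      exact ⟨rfl, rfl⟩
    have hfix : ∀ i : Fin b, y.right (Fin.natAdd a i) = Fin.natAdd a i := fun i =>
      (hpot i _ rfl).1
    obtain ⟨x, rfl⟩ := exists_eq_directSum_one (y := y) ⟨hfix, fun i => by
      have := (hpot i _ rfl).2
      rw [hfix, mul_one] at this
      exact this.symm⟩
    rw [directSum_one_inv_mul, modifiedType_directSum_one] at h2
    rw [modifiedType_directSum_one] at h1
    exact ⟨x, Finset.mem_filter.2 ⟨Finset.mem_univ _, h1, h2⟩, rfl⟩

/-- The coefficients of top degree of `K_l(n) K_m(n)` do not depend on `n`. -/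
theorem coeff_stable (l m : PartFun Γ) (z : Wreath Γ a) (z' : Wreath Γ b)
    (h : modifiedType z = modifiedType z') (hd : elemDegree z = degree l + degree m) :
    (classSum a l * classSum a m).coeff z = (classSum b l * classSum b m).coeff z' := by
  wlog hab : a ≤ b generalizing a b
  · exact (this z' z h.symm (by rw [elemDegree, ← h]; exact hd) (le_of_not_ge hab)).symm
  obtain ⟨c, rfl⟩ := Nat.exists_eq_add_of_le hab
  rw [← coeff_directSum_one (b := c) l m z hd]
  exact coeff_eq_of_isConj (classK _ l * classK _ m)
    (isConj_of_modifiedType_eq ((modifiedType_directSum_one z c).trans h))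

end Stability

/-! ### Elements with trivial cycle-products and the subgroup $S_n$ -/

section Untwisted

variable {Γ : Type*} [Group Γ] {n : ℕ}

/-- The lengths of the cycles of `σ`, lowered by one. -/
noncomputable def reducedCycleType (σ : Equiv.Perm (Fin n)) : IntPartition :=
  ⟨(((cycles σ).val.map Finset.card).map fun r => r - 1).filter fun r => r ≠ 0, by simp⟩

theorem modifiedType_eq_atId {x : Wreath Γ n} (h : ∀ i, loopLabel x i = 1) :
    modifiedType x = atId Γ (reducedCycleType x.right) := by
  classical
  have hcyc : ∀ c, cyclesIn x c = if c = idClass Γ then cycles x.right else ∅ := by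
    intro c
    have key : ∀ i, cycleThrough x.right i ∈ cyclesIn x c ↔ c = idClass Γ := fun i => by
      rw [cycleThrough_mem_cyclesIn, h, eq_comm]
    split_ifs with hc
    · ext C
      refine ⟨fun hC => (mem_cyclesIn.1 hC).1, fun hC => ?_⟩
      obtain ⟨i, rfl⟩ := mem_cycles.1 hC
      exact (key i).2 hc
    · refine Finset.eq_empty_of_forall_notMem fun C hC => hc ?_
      obtain ⟨i, rfl⟩ := mem_cycles.1 (mem_cyclesIn.1 hC).1
      exact (key i).1 hC
  funext c
  apply Subtype.ext
  unfold modifiedType lower atId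
  by_cases hc : c = idClass Γ
  · simp only [if_pos hc]
    show (((cyclesIn x c).val.map Finset.card).map fun r => r - 1).filter _ = _
    rw [hcyc, if_pos hc]
    rfl
  · simp only [if_neg hc]
    show (cyclesIn x c).val.map Finset.card = _
    rw [hcyc, if_neg hc]
    rfl

theorem loopLabel_inr (σ : Equiv.Perm (Fin n)) (i : Fin n) :
    loopLabel (SemidirectProduct.inr σ : Wreath Γ n) i = 1 := by
  unfold loopLabel
  rw [← map_pow]
  rfl

theorem modifiedType_inr (σ : Equiv.Perm (Fin n)) :
    modifiedType (SemidirectProduct.inr σ : Wreath Γ n) = atId Γ (reducedCycleType σ) :=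
  modifiedType_eq_atId (loopLabel_inr σ)

theorem modifiedType_unit (w : Wreath Unit n) :
    modifiedType w = atId Unit (reducedCycleType w.right) :=
  modifiedType_eq_atId fun _ => rfl

theorem atId_idClass (p : IntPartition) : atId Γ p (idClass Γ) = p := if_pos rfl

theorem atId_inj {p q : IntPartition} : atId Γ p = atId Γ q ↔ p = q :=
  ⟨fun h => by rw [← atId_idClass (Γ := Γ) p, h, atId_idClass], fun h => h ▸ rfl⟩

theorem not_hasNontrivial_atId (p : IntPartition) : ¬ HasNontrivial (atId Γ p) := by
  rintro ⟨c, hc, h⟩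
  exact h (by rw [atId, if_neg hc])

theorem eq_atId_of_not_hasNontrivial {ρ : PartFun Γ} (h : ¬ HasNontrivial ρ) :
    ρ = atId Γ (ρ (idClass Γ)) := by
  funext c
  by_cases hc : c = idClass Γ
  · rw [hc, atId_idClass]
  · rw [atId, if_neg hc]
    apply Subtype.ext
    by_contra h'
    exact h ⟨c, hc, h'⟩

theorem eq_atId_unit (ρ : PartFun Unit) : ρ = atId Unit (ρ (idClass Unit)) := by
  refine eq_atId_of_not_hasNontrivial ?_
  rintro ⟨c, hc, -⟩
  obtain ⟨g, rfl⟩ := c.exists_rep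
  exact hc rfl

theorem loopLabel_eq_one_of_not_hasNontrivial {x : Wreath Γ n}
    (h : ¬ HasNontrivial (modifiedType x)) (i : Fin n) : loopLabel x i = 1 := by
  by_contra hi
  have hc : ConjClasses.mk (loopLabel x i) ≠ idClass Γ := fun hc =>
    hi (mem_flat.1 (cycleThrough_mem_cyclesIn.2 hc))
  refine h ⟨_, hc, ?_⟩
  unfold modifiedType lower
  rw [if_neg hc]
  show (cyclesIn x _).val.map Finset.card ≠ 0
  rw [Ne, Multiset.map_eq_zero, Finset.val_eq_zero]
  exact Finset.ne_empty_of_mem (cycleThrough_mem_cyclesIn.2 rfl)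

/-- Such types are realised in $S_n$ without enlarging `n`, so restriction to $S_n$ loses none of
their coefficients. -/
theorem modifiedType_eq_inr_of_not_hasNontrivial {x : Wreath Γ n}
    (h : ¬ HasNontrivial (modifiedType x)) :
    modifiedType x = modifiedType (SemidirectProduct.inr x.right : Wreath Γ n) := by
  rw [modifiedType_eq_atId (loopLabel_eq_one_of_not_hasNontrivial h), modifiedType_inr]

theorem degree_atId [Finite Γ] (p : IntPartition) : degree (atId Γ p) = p.1.sum := by
  classical
  have : Fintype (ConjClasses Γ) := Fintype.ofFinite _
  rw [degree, finsum_eq_sum_of_fintype, Finset.sum_eq_single (idClass Γ)]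
  · rw [atId_idClass]
  · intro c _ hc
    rw [atId, if_neg hc]
    rfl
  · exact fun h => absurd (Finset.mem_univ _) h

/-- A permutation has the same degree in $\Gamma_n$ as in $S_n$, so the condition of additive
degrees is the same in both. -/
theorem elemDegree_inr [Finite Γ] (w : Wreath Unit n) :
    elemDegree (SemidirectProduct.inr w.right : Wreath Γ n) = elemDegree w := by
  rw [elemDegree, modifiedType_inr, degree_atId, elemDegree, modifiedType_unit, degree_atId]

/-- An element with trivial labels has only such elements as factors of additive degree. -/
theorem eq_inr_of_geodesic [Finite Γ] {x : Wreath Γ n} {σ : Equiv.Perm (Fin n)}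
    (h : elemDegree x + elemDegree (x⁻¹ * SemidirectProduct.inr σ) =
      elemDegree (SemidirectProduct.inr σ : Wreath Γ n)) :
    x = SemidirectProduct.inr x.right := by
  -- The subgroup $S_n$ consists of the elements having the constant 1 as a potential on all
  -- letters.
  have hpot : Potential (SemidirectProduct.inr σ : Wreath Γ n) Set.univ fun _ => 1 :=
    fun k _ => ⟨trivial, (mul_one (1 : Γ)).symm⟩
  have hx : Potential x Set.univ fun _ => 1 :=
    Potential.of_geodesic (y := x⁻¹ * SemidirectProduct.inr σ)
      (by rw [mul_inv_cancel_left]; exact h) (by rw [mul_inv_cancel_left]; exact hpot)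
  refine SemidirectProduct.ext (funext fun i => ?_) rfl
  obtain ⟨k, rfl⟩ := x.right.surjective i
  have := (hx k trivial).2
  rw [mul_one] at this
  exact this.symm

end Untwisted

/-! ### Restriction to $S_n$ and its kernel -/

section Reduction

variable {Γ : Type*} [Group Γ] [Finite Γ] {n : ℕ}

/-- Permutations of equal modified type in $S_n$ have equal modified type in $\Gamma_n$, so the
restricted coefficients again form a function of the type. -/
theorem exists_restrict (a : GrRing Γ n) : ∃ b : GrRing Unit n, ∀ w,
    grEval w b = grEval (SemidirectProduct.inr w.right : Wreath Γ n) a := by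
  refine exists_grEval_eq _ fun w w' h => grEval_eq_of_modifiedType_eq ?_ a
  rw [modifiedType_unit, modifiedType_unit, atId_inj] at h
  rw [modifiedType_inr, modifiedType_inr, h]

theorem inr_right_unit (w : Wreath Unit n) : SemidirectProduct.inr w.right = w :=
  SemidirectProduct.ext (Subsingleton.elim _ _) rfl

variable (Γ n)

/-- The restriction of symbols from `Γₙ` to `Sₙ`. -/
noncomputable def restrict : GrRing Γ n →+* GrRing Unit n :=
  RingHom.mk'
    { toFun := fun a => (exists_restrict a).choose
      map_one' := by
        classical
        refine grEval_ext fun w => ?_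
        rw [(exists_restrict _).choose_spec, grEval_one, grEval_one]
        refine if_congr ?_ rfl rfl
        rw [← map_one SemidirectProduct.inr, SemidirectProduct.inr_inj]
        exact ⟨fun h => by rw [← inr_right_unit w, h, map_one], fun h => by rw [h]; rfl⟩
      map_mul' := by
        intro a b
        refine grEval_ext fun w => ?_
        rw [(exists_restrict _).choose_spec, grEval_mul, grEval_mul]
        have hinj : Set.InjOn (fun v : Wreath Unit n =>
            (SemidirectProduct.inr v.right : Wreath Γ n)) ((Finset.univ : Finset (Wreath Unit n)) : Set (Wreath Unit n)) := by
          intro v _ v' _ h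
          rw [← inr_right_unit v, ← inr_right_unit v', SemidirectProduct.inr_injective h]
        symm
        -- Both sides are sums over additive factorisations. Those in $\Gamma_n$ with left factor
        -- outside $S_n$ do not exist, by `eq_inr_of_geodesic`; the others correspond term by term.
        refine Finset.sum_of_injOn _ hinj (fun _ _ => Finset.mem_coe.2 (Finset.mem_univ _))
          (fun x _ hx => ?_) fun v _ => ?_
        · refine if_neg fun h => hx ⟨SemidirectProduct.inr x.right,
            Finset.mem_coe.2 (Finset.mem_univ _), ?_⟩
          exact (eq_inr_of_geodesic h).symm
        · have hv : (SemidirectProduct.inr v.right : Wreath Γ n)⁻¹ *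
              SemidirectProduct.inr w.right = SemidirectProduct.inr (v⁻¹ * w).right := by
            rw [← map_inv, ← map_mul]
            rfl
          rw [hv, elemDegree_inr, elemDegree_inr, elemDegree_inr,
            (exists_restrict _).choose_spec, (exists_restrict _).choose_spec] }
    fun a b => by
      refine grEval_ext fun w => ?_
      show grEval w (exists_restrict (a + b)).choose = grEval w
        ((exists_restrict a).choose + (exists_restrict b).choose)
      rw [map_add, (exists_restrict _).choose_spec, (exists_restrict _).choose_spec,
        (exists_restrict _).choose_spec, map_add]

variable {Γ n}

theorem grEval_restrict (a : GrRing Γ n) (w : Wreath Unit n) :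
    grEval w (restrict Γ n a) = grEval (SemidirectProduct.inr w.right : Wreath Γ n) a :=
  (exists_restrict a).choose_spec w

theorem restrict_grK_atId (p : IntPartition) :
    restrict Γ n (grK n (atId Γ p)) = grK n (atId Unit p) := by
  refine grEval_ext fun w => ?_
  rw [grEval_restrict, grEval_grK, grEval_grK, modifiedType_inr, modifiedType_unit]
  simp only [atId_inj]

theorem restrict_grK_of_hasNontrivial {ρ : PartFun Γ} (h : HasNontrivial ρ) :
    restrict Γ n (grK n ρ) = 0 := by
  refine grEval_ext fun w => ?_
  rw [grEval_restrict, grEval_grK, modifiedType_inr, if_neg, map_zero]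
  rintro rfl
  exact not_hasNontrivial_atId _ h

theorem mem_ker_restrict (a : GrRing Γ n) : a ∈ RingHom.ker (restrict Γ n) ↔ a ∈ grI Γ n := by
  classical
  rw [RingHom.mem_ker]
  constructor
  · intro ha
    rw [eq_sum_grK a]
    refine sum_mem fun ρ hρ => ?_
    obtain ⟨z, -, rfl⟩ := Finset.mem_image.1 hρ
    -- If the type is concentrated at $c^0$, its coefficient can be read at an element of $S_n$,
    -- where it is a coefficient of the restriction and so vanishes.
    by_cases hz : HasNontrivial (modifiedType z)
    · exact (grI Γ n).zsmul_mem (AddSubgroup.subset_closure ⟨_, hz, rfl⟩) _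
    · have hf : (fun z : Wreath Γ n => grEval z a).FactorsThrough modifiedType :=
        fun _ _ h => grEval_eq_of_modifiedType_eq h a
      have h0 := congrArg (grEval (SemidirectProduct.inr z.right : Wreath Unit n)) ha
      rw [grEval_restrict, map_zero] at h0
      rw [hf.extend_apply, grEval_eq_of_modifiedType_eq
        (modifiedType_eq_inr_of_not_hasNontrivial hz) a]
      rw [show grEval (SemidirectProduct.inr z.right : Wreath Γ n) a = 0 from h0, zero_smul]
      exact zero_mem _
  · intro ha
    have : grI Γ n ≤ (restrict Γ n).toAddMonoidHom.ker := by
      refine (AddSubgroup.closure_le _).2 ?_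
      rintro _ ⟨ρ, hρ, rfl⟩
      exact restrict_grK_of_hasNontrivial hρ
    exact this ha

theorem closure_grK_atId_unit :
    AddSubgroup.closure (Set.range fun p => grK n (atId Unit p)) = ⊤ := by
  classical
  refine eq_top_iff.2 fun a _ => ?_
  rw [eq_sum_grK a]
  refine sum_mem fun ρ _ => AddSubgroup.zsmul_mem _ ?_ _
  exact AddSubgroup.subset_closure
    (Set.mem_range.2 ⟨ρ (idClass Unit), congrArg (grK n) (eq_atId_unit ρ).symm⟩)

/-- A ring homomorphism onto a ring spanned by the images `k' p` of elements `k p` identifies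
the quotient by its kernel, uniquely so as to match the `k p` with the `k' p`. -/
theorem existsUnique_quotient_ker_equiv {A B ι : Type*} [CommRing A] [CommRing B] (f : A →+* B)
    {k : ι → A} {k' : ι → B} (hk : ∀ p, f (k p) = k' p)
    (hspan : AddSubgroup.closure (Set.range k') = ⊤) :
    ∃! e : (A ⧸ RingHom.ker f) ≃+* B, ∀ p, e (Ideal.Quotient.mk (RingHom.ker f) (k p)) = k' p := by
  have hsurj : Function.Surjective f := by
    have h : AddSubgroup.closure (Set.range k') ≤ f.toAddMonoidHom.range := by
      refine (AddSubgroup.closure_le _).2 ?_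
      rintro _ ⟨p, rfl⟩
      exact ⟨k p, hk p⟩
    rw [hspan] at h
    exact fun b => h (AddSubgroup.mem_top b)
  refine ⟨RingHom.quotientKerEquivOfSurjective hsurj, fun p => hk p, fun e he => ?_⟩
  -- The inverses are compared because spanning is assumed in the target, where the `k' p` live.
  have h : ∀ b, e.symm b = (RingHom.quotientKerEquivOfSurjective hsurj).symm b := by
    intro b
    have hb : b ∈ AddSubgroup.closure (Set.range k') := by rw [hspan]; trivial
    induction hb using AddSubgroup.closure_induction with
    | mem b hb =>
      obtain ⟨p, rfl⟩ := hb
      rw [RingEquiv.symm_apply_eq]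
      have h1 : (RingHom.quotientKerEquivOfSurjective hsurj).symm (k' p) =
          Ideal.Quotient.mk (RingHom.ker f) (k p) := by
        rw [RingEquiv.symm_apply_eq]
        exact (hk p).symm
      rw [h1, he]
    | zero => rw [map_zero, map_zero]
    | add b c _ _ hb hc => rw [map_add, map_add, hb, hc]
    | neg b _ hb => rw [map_neg, map_neg, hb]
  refine RingEquiv.ext fun a => ?_
  rw [← RingEquiv.symm_apply_apply (RingHom.quotientKerEquivOfSurjective hsurj) a, ← h,
    RingEquiv.apply_symm_apply, h, RingEquiv.apply_symm_apply]

end Reduction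

/-! ### The Farahat–Higman ring: basis, grading and restriction -/

section StableRing

variable {Γ : Type*} [Group Γ] [Finite Γ]

theorem fhRing_ext {a b : FHRing Γ}
    (h : ∀ (n : ℕ) (z : Wreath Γ n), grEval z (a.1 n) = grEval z (b.1 n)) : a = b :=
  Subtype.ext (funext fun n => grEval_ext (h n))

theorem fhK_apply (ρ : PartFun Γ) (n : ℕ) : (fhK ρ).1 n = grK n ρ := rfl

theorem fhRing_sum_apply {ι : Type*} (s : Finset ι) (c : ι → ℤ) (k : ι → FHRing Γ) (n : ℕ) :
    (∑ i ∈ s, c i • k i).1 n = ∑ i ∈ s, c i • (k i).1 n := by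
  simp [Finset.sum_apply]

theorem finite_intPartition_sum_le (d : ℕ) : {p : IntPartition | p.1.sum ≤ d}.Finite := by
  refine Set.Finite.of_finite_image (f := Subtype.val) ?_ Subtype.val_injective.injOn
  -- A partition with sum at most `d` has at most `d` parts, each at most `d`, so it is contained in
  -- the multiset with `d` copies of each of $0,\dots,d$.
  refine (Set.finite_Iic (d • Multiset.range (d + 1))).subset ?_
  rintro _ ⟨p, hp, rfl⟩
  have hp' : p.1.sum ≤ d := hp
  rw [Set.mem_Iic, Multiset.le_iff_count]
  intro r
  by_cases hr : r ∈ p.1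
  · have h1 : r ≤ d := (Multiset.le_sum_of_mem hr).trans hp'
    have hpos : ∀ x ∈ p.1, 1 ≤ x := fun x hx => Nat.one_le_iff_ne_zero.2 fun h => p.2 (h ▸ hx)
    have h2 : p.1.card ≤ p.1.sum := by
      simpa using Multiset.card_nsmul_le_sum hpos
    rw [Multiset.count_nsmul, Multiset.count_eq_one_of_mem (Multiset.nodup_range _)
      (Multiset.mem_range.2 (Nat.lt_succ_of_le h1)), mul_one]
    exact (Multiset.count_le_card _ _).trans (h2.trans hp')
  · rw [Multiset.count_eq_zero_of_notMem hr]
    exact Nat.zero_le _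

variable (Γ) in
theorem finite_degree_eq (d : ℕ) : {ρ : PartFun Γ | degree ρ = d}.Finite := by
  have : Fintype (ConjClasses Γ) := Fintype.ofFinite _
  refine (Set.Finite.pi' fun _ : ConjClasses Γ => finite_intPartition_sum_le d).subset ?_
  intro ρ hρ c
  have h : degree ρ = d := hρ
  rw [degree, finsum_eq_sum_of_fintype] at h
  rw [Set.mem_ofPred_eq, ← h]
  exact Finset.single_le_sum (f := fun c => (ρ c).1.sum) (fun _ _ => Nat.zero_le _)
    (Finset.mem_univ c)

theorem grEval_grK_mul {n : ℕ} (l m : PartFun Γ) (z : Wreath Γ n) :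
    grEval z (grK n l * grK n m) =
      if elemDegree z = degree l + degree m then (classSum n l * classSum n m).coeff z else 0 := by
  classical
  rw [grEval_mul, coeff_mul_eq_sum]
  simp only [grEval_grK, classSum_coeff, ite_zero_mul_ite_zero, mul_one]
  split_ifs with hz
  · refine Finset.sum_congr rfl fun x _ => ?_
    by_cases hx : modifiedType x = l ∧ modifiedType (x⁻¹ * z) = m
    · rw [if_pos]
      rw [hz, elemDegree_eq_of_modifiedType hx.1, elemDegree_eq_of_modifiedType hx.2]
    · rw [if_neg hx, ite_self]
  · refine Finset.sum_eq_zero fun x _ => ?_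
    by_cases hx : modifiedType x = l ∧ modifiedType (x⁻¹ * z) = m
    · rw [if_neg]
      rw [elemDegree_eq_of_modifiedType hx.1, elemDegree_eq_of_modifiedType hx.2]
      exact fun h => hz h.symm
    · rw [if_neg hx, ite_self]

theorem fhK_mem_fhGrade (ρ : PartFun Γ) : fhK ρ ∈ fhGrade Γ (degree ρ) :=
  AddSubgroup.subset_closure ⟨ρ, rfl, rfl⟩

/-- Stability makes one finite integral combination valid in all components simultaneously. -/
theorem fhK_mul_mem (l m : PartFun Γ) : fhK l * fhK m ∈ fhGrade Γ (degree l + degree m) := by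
  classical
  -- Each structure constant is read at one chosen element of the required type; `coeff_stable`
  -- makes the choice, and its `N`, immaterial.
  choose N z hz using exists_modifiedType_eq (Γ := Γ)
  let S := (finite_degree_eq Γ (degree l + degree m)).toFinset
  have key : fhK l * fhK m =
      ∑ v ∈ S, (classSum (N v) l * classSum (N v) m).coeff (z v) • fhK v := by
    refine fhRing_ext fun n w => ?_
    rw [fhRing_sum_apply]
    show grEval w (grK n l * grK n m) = _
    rw [grEval_grK_mul]
    simp only [fhK_apply, map_sum, map_zsmul, grEval_grK, smul_eq_mul, mul_ite, mul_one, mul_zero,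
      Finset.sum_ite_eq]
    refine if_ctx_congr ?_ (fun h => ?_) fun _ => rfl
    · rw [Set.Finite.mem_toFinset]
      rfl
    · refine coeff_stable l m w (z (modifiedType w)) (hz _).symm ?_
      rw [Set.Finite.mem_toFinset] at h
      exact h
  rw [key]
  refine sum_mem fun v hv => AddSubgroup.zsmul_mem _ ?_ _
  have hv' : degree v = degree l + degree m :=
    (finite_degree_eq Γ (degree l + degree m)).mem_toFinset.1 hv
  rw [← hv']
  exact fhK_mem_fhGrade v

variable (Γ) in
-- The identity of every $\Gamma_n$ has empty modified type, named here through $\Gamma_0$, and no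
-- other element has that type.
theorem exists_one_eq_fhK : ∃ ρ : PartFun Γ, degree ρ = 0 ∧ (1 : FHRing Γ) = fhK ρ := by
  classical
  have h1 : ∀ n, modifiedType (1 : Wreath Γ n) = modifiedType (1 : Wreath Γ 0) := by
    intro n
    funext c
    apply Subtype.ext
    unfold modifiedType lower
    by_cases hc : c = idClass Γ
    · simp only [if_pos hc, cycleType_one, Multiset.map_map]
      simp [Multiset.filter_eq_nil, Multiset.mem_replicate]
    · simp only [if_neg hc, cycleType_one]
      simp [hc]
  refine ⟨modifiedType (1 : Wreath Γ 0), norm_one, fhRing_ext fun n z => ?_⟩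
  show grEval z (1 : GrRing Γ n) = grEval z (grK n _)
  rw [grEval_one, grEval_grK]
  refine if_congr ⟨fun h => by rw [h, h1], fun h => ?_⟩ rfl rfl
  rw [← h1 n] at h
  exact isConj_one_left.1 (isConj_of_modifiedType_eq h)

theorem fhGrade_le_span (k : ℕ) :
    fhGrade Γ k ≤ (Submodule.span ℤ (Set.range (fhK (Γ := Γ)))).toAddSubgroup := by
  refine (AddSubgroup.closure_le _).2 ?_
  rintro _ ⟨ρ, -, rfl⟩
  exact Submodule.subset_span ⟨ρ, rfl⟩

theorem span_fhK : ⊤ ≤ Submodule.span ℤ (Set.range (fhK (Γ := Γ))) := by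
  rintro ⟨a, ha⟩ -
  induction ha using Subring.closure_induction with
  | mem a ha =>
    obtain ⟨ρ, rfl⟩ := ha
    exact Submodule.subset_span ⟨ρ, rfl⟩
  | zero => exact zero_mem _
  | one =>
    obtain ⟨ρ, -, h⟩ := exists_one_eq_fhK Γ
    exact Submodule.subset_span ⟨ρ, h.symm⟩
  | add a b _ _ ha hb => exact add_mem ha hb
  | neg a _ ha => exact neg_mem ha
  | mul a b ha' hb' ha hb =>
    have h := Submodule.mul_mem_mul ha hb
    rw [Submodule.span_mul_span] at h
    refine Submodule.span_le.2 ?_ h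
    rintro _ ⟨_, ⟨l, rfl⟩, _, ⟨m, rfl⟩, rfl⟩
    exact fhGrade_le_span _ (fhK_mul_mem l m)

/-- At a fixed level many $K_\rho(n)$ vanish, but each `ρ` is realised in some $\Gamma_n$, and
evaluation there isolates its coefficient. -/
theorem linearIndependent_fhK : LinearIndependent ℤ (fhK (Γ := Γ)) := by
  classical
  rw [linearIndependent_iff']
  intro s c h ρ hρ
  obtain ⟨n, z, rfl⟩ := exists_modifiedType_eq ρ
  have h1 := congrArg (fun a : FHRing Γ => grEval z (a.1 n)) h
  simp only [fhRing_sum_apply, fhK_apply, map_sum, map_zsmul, grEval_grK, smul_eq_mul, mul_ite,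
    mul_one, mul_zero, Finset.sum_ite_eq, if_pos hρ] at h1
  rw [h1]
  exact map_zero _

variable (Γ) in
/-- The basis `(K_ρ)` of the Farahat–Higman ring. -/
noncomputable def fhBasis : Module.Basis (PartFun Γ) ℤ (FHRing Γ) :=
  Module.Basis.mk linearIndependent_fhK span_fhK

theorem fhBasis_apply (ρ : PartFun Γ) : fhBasis Γ ρ = fhK ρ := Module.Basis.mk_apply _ _ _

theorem fhBasis_repr (a : FHRing Γ) {n : ℕ} (z : Wreath Γ n) :
    (fhBasis Γ).repr a (modifiedType z) = grEval z (a.1 n) := by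
  classical
  conv_rhs => rw [← (fhBasis Γ).linearCombination_repr a, Finsupp.linearCombination_apply,
    Finsupp.sum, fhRing_sum_apply]
  simp only [fhBasis_apply, fhK_apply, map_sum, map_zsmul, grEval_grK, smul_eq_mul, mul_ite,
    mul_one, mul_zero, Finset.sum_ite_eq]
  split_ifs with h
  · rfl
  · exact Finsupp.notMem_support_iff.1 h

/-- Assigning degrees to a basis decomposes the additive group; the ring structure respects it as
soon as products of basis elements do. -/
theorem nonempty_gradedRing_of_basis {A ι : Type*} [CommRing A] (b : Module.Basis ι ℤ A) (d : ι → ℕ)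
    (𝒜 : ℕ → AddSubgroup A) (h𝒜 : ∀ k, 𝒜 k = AddSubgroup.closure {a | ∃ i, d i = k ∧ a = b i})
    (hone : 1 ∈ 𝒜 0) (hmul : ∀ i j, b i * b j ∈ 𝒜 (d i + d j)) : Nonempty (GradedRing 𝒜) := by
  classical
  obtain rfl : 𝒜 = fun k => AddSubgroup.closure {a | ∃ i, d i = k ∧ a = b i} := funext h𝒜
  have hb : ∀ i, b i ∈ AddSubgroup.closure {a | ∃ j, d j = d i ∧ a = b j} := fun i =>
    AddSubgroup.subset_closure ⟨i, rfl, rfl⟩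
  set 𝒜 : ℕ → AddSubgroup A := fun k => AddSubgroup.closure {a | ∃ i, d i = k ∧ a = b i} with h𝒜'
  have hmon : SetLike.GradedMonoid 𝒜 :=
    { one_mem := hone
      mul_mem := by
        intro i j x y hx hy
        induction hx using AddSubgroup.closure_induction with
        | zero => rw [zero_mul]; exact zero_mem _
        | add a a' _ _ ha ha' => rw [add_mul]; exact add_mem ha ha'
        | neg a _ ha => rw [neg_mul]; exact neg_mem ha
        | mem a ha =>
          obtain ⟨l, rfl, rfl⟩ := ha
          induction hy using AddSubgroup.closure_induction with
          | zero => rw [mul_zero]; exact zero_mem _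
          | add a a' _ _ ha ha' => rw [mul_add]; exact add_mem ha ha'
          | neg a _ ha => rw [mul_neg]; exact neg_mem ha
          | mem y hy =>
            obtain ⟨m, rfl, rfl⟩ := hy
            exact hmul l m }
  let D : A →+ ⨁ k, 𝒜 k := (b.constr ℤ fun i =>
    DirectSum.of (fun k => 𝒜 k) (d i) ⟨b i, hb i⟩).toAddMonoidHom
  have hD : ∀ i, D (b i) = DirectSum.of (fun k => 𝒜 k) (d i) ⟨b i, hb i⟩ := fun i =>
    b.constr_basis ℤ (fun i => DirectSum.of (fun k => 𝒜 k) (d i) ⟨b i, hb i⟩) i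
  have hdec : DirectSum.Decomposition 𝒜 := by
    refine DirectSum.Decomposition.ofAddHom 𝒜 D ?_ ?_
    · refine AddMonoidHom.ext fun a => ?_
      induction b.mem_span a using Submodule.span_induction with
      | mem a ha =>
        obtain ⟨i, rfl⟩ := ha
        rw [AddMonoidHom.comp_apply, hD, DirectSum.coeAddMonoidHom_of]
        rfl
      | zero => rw [map_zero, map_zero]
      | add a b _ _ ha hb => rw [map_add, map_add, ha, hb]
      | smul c a _ ha => rw [map_zsmul, map_zsmul, ha]
    · refine DirectSum.addHom_ext fun k a => ?_
      obtain ⟨a, ha⟩ := a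
      rw [AddMonoidHom.comp_apply, DirectSum.coeAddMonoidHom_of, AddMonoidHom.id_apply]
      induction ha using AddSubgroup.closure_induction with
      | mem a ha => obtain ⟨ρ, rfl, rfl⟩ := ha; exact hD ρ
      | zero => exact (map_zero D).trans (map_zero (DirectSum.of _ k)).symm
      | add a b ha' hb' ha hb =>
        exact (map_add D a b).trans ((congrArg₂ (· + ·) ha hb).trans
          (map_add (DirectSum.of (fun k => 𝒜 k) k) ⟨a, ha'⟩ ⟨b, hb'⟩).symm)
      | neg a ha' ha =>
        exact (map_neg D a).trans ((congrArg Neg.neg ha).trans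
          (map_neg (DirectSum.of (fun k => 𝒜 k) k) ⟨a, ha'⟩).symm)
  exact ⟨{ hmon, hdec with }⟩

variable (Γ) in
theorem nonempty_gradedRing_fhGrade : Nonempty (GradedRing (fhGrade Γ)) := by
  refine nonempty_gradedRing_of_basis (fhBasis Γ) degree (fhGrade Γ) (fun k => ?_) ?_ fun l m => ?_
  · simp only [fhBasis_apply]
    rfl
  · obtain ⟨ρ, h0, h⟩ := exists_one_eq_fhK Γ
    rw [h, ← h0]
    exact fhK_mem_fhGrade ρ
  · rw [fhBasis_apply, fhBasis_apply]
    exact fhK_mul_mem l m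

variable (Γ) in
/-- The restriction of all components from `Γₙ` to `Sₙ`. -/
noncomputable def piRestrict : (∀ n, GrRing Γ n) →+* ∀ n, GrRing Unit n :=
  RingHom.mk'
    { toFun := fun a n => restrict Γ n (a n)
      map_one' := funext fun _ => map_one _
      map_mul' := fun _ _ => funext fun _ => map_mul _ _ _ }
    fun _ _ => funext fun n => map_add (restrict Γ n) _ _

/-- It suffices to check generators: a family $K_\rho$ restricts either to zero or to the family of
the same partition for $S_n$. -/
theorem piRestrict_mem (a : FHRing Γ) : piRestrict Γ a.1 ∈
    Subring.closure (Set.range fun (ρ : PartFun Unit) (n : ℕ) => grK n ρ) := by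
  have h : Subring.closure (Set.range fun (ρ : PartFun Γ) (n : ℕ) => grK n ρ) ≤ (Subring.closure
      (Set.range fun (ρ : PartFun Unit) (n : ℕ) => grK n ρ)).comap (piRestrict Γ) := by
    refine Subring.closure_le.2 ?_
    rintro _ ⟨ρ, rfl⟩
    rw [SetLike.mem_coe, Subring.mem_comap]
    by_cases hρ : HasNontrivial ρ
    · rw [show piRestrict Γ (fun n => grK n ρ) = 0 from
        funext fun n => restrict_grK_of_hasNontrivial hρ]
      exact zero_mem _
    · rw [eq_atId_of_not_hasNontrivial hρ]
      exact Subring.subset_closure ⟨_, funext fun n => (restrict_grK_atId _).symm⟩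
  exact h a.2

variable (Γ) in
/-- The restriction `𝒢_Γ → 𝒢`. -/
noncomputable def fhRestrict : FHRing Γ →+* FHRing Unit :=
  ((piRestrict Γ).comp (Subring.subtype _)).codRestrict _ piRestrict_mem

theorem fhRestrict_apply (a : FHRing Γ) (n : ℕ) :
    (fhRestrict Γ a).1 n = restrict Γ n (a.1 n) := rfl

theorem fhRestrict_fhK_atId (p : IntPartition) :
    fhRestrict Γ (fhK (atId Γ p)) = fhK (atId Unit p) :=
  Subtype.ext (funext fun _ => restrict_grK_atId p)

theorem mem_ker_fhRestrict (a : FHRing Γ) : a ∈ RingHom.ker (fhRestrict Γ) ↔ a ∈ fhI Γ := by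
  rw [RingHom.mem_ker]
  constructor
  · intro ha
    rw [← (fhBasis Γ).linearCombination_repr a, Finsupp.linearCombination_apply]
    refine sum_mem fun ρ hρ => ?_
    beta_reduce
    rw [fhBasis_apply]
    refine (fhI Γ).zsmul_mem (AddSubgroup.subset_closure ⟨ρ, ?_, rfl⟩) _
    by_contra h
    rw [Finsupp.mem_support_iff] at hρ
    obtain ⟨n, z, rfl⟩ := exists_modifiedType_eq ρ
    refine hρ ?_
    -- The coordinate at `ρ` may be read at any element of that type, in particular at a
    -- permutation, where it is a coefficient of the restriction.
    rw [modifiedType_eq_inr_of_not_hasNontrivial h, fhBasis_repr]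
    have h1 := congrArg
      (fun b : FHRing Unit => grEval (SemidirectProduct.inr z.right : Wreath Unit n) (b.1 n)) ha
    simp only [fhRestrict_apply, grEval_restrict] at h1
    exact h1.trans (map_zero _)
  · intro ha
    have : fhI Γ ≤ (fhRestrict Γ).toAddMonoidHom.ker := by
      refine (AddSubgroup.closure_le _).2 ?_
      rintro _ ⟨ρ, hρ, rfl⟩
      exact Subtype.ext (funext fun n => restrict_grK_of_hasNontrivial hρ)
    exact this ha

theorem closure_fhK_atId_unit :
    AddSubgroup.closure (Set.range fun p => fhK (atId Unit p)) = ⊤ := by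
  refine eq_top_iff.2 fun a _ => ?_
  rw [← (fhBasis Unit).linearCombination_repr a, Finsupp.linearCombination_apply]
  refine sum_mem fun ρ _ => ?_
  beta_reduce
  rw [fhBasis_apply]
  refine AddSubgroup.zsmul_mem _ ?_ _
  exact AddSubgroup.subset_closure
    (Set.mem_range.2 ⟨ρ (idClass Unit), congrArg fhK (eq_atId_unit ρ).symm⟩)

theorem isHomogeneous_of_mem_iff_fhI [GradedRing (fhGrade Γ)] {J : Ideal (FHRing Γ)}
    (hJ : ∀ a, a ∈ J ↔ a ∈ fhI Γ) : J.IsHomogeneous (fhGrade Γ) := by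
  intro k a ha
  rw [hJ] at ha ⊢
  induction ha using AddSubgroup.closure_induction with
  | mem a ha =>
    obtain ⟨ρ, hρ, rfl⟩ := ha
    by_cases hk : degree ρ = k
    · subst hk
      rw [DirectSum.decompose_of_mem_same _ (fhK_mem_fhGrade ρ)]
      exact AddSubgroup.subset_closure ⟨ρ, hρ, rfl⟩
    · rw [DirectSum.decompose_of_mem_ne _ (fhK_mem_fhGrade ρ) hk]
      exact zero_mem _
  | zero => rw [DirectSum.decompose_zero]; exact zero_mem _
  | add a b _ _ ha hb =>
    rw [DirectSum.decompose_add, DirectSum.add_apply, AddSubgroup.coe_add]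
    exact add_mem ha hb
  | neg a _ ha =>
    rw [DirectSum.decompose_neg]
    exact neg_mem ha

end StableRing

end FarahatHigman

/-! ### The main theorem -/

open FarahatHigman
theorem mainTheorem6 (Γ : Type*) [Group Γ] [Finite Γ] :
    (∀ n : ℕ, ∃ J : Ideal (GrRing Γ n),
      (∀ a, a ∈ J ↔ a ∈ grI Γ n) ∧
      (∀ a ∈ J, ∀ k : ℕ, DirectSum.of _ k (a k) ∈ J) ∧
      ∃! e : (GrRing Γ n ⧸ J) ≃+* GrRing Unit n,
        ∀ p : IntPartition,
          e (Ideal.Quotient.mk J (grK n (atId Γ p))) =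
            grK n (atId Unit p)) ∧
    (∃ b : Module.Basis (PartFun Γ) ℤ (FHRing Γ),
      (∀ l, b l = fhK l) ∧
      ∀ l m v : PartFun Γ,
        (degree v ≠ degree l + degree m →
          b.repr (fhK l * fhK m) v = 0) ∧
        (degree v = degree l + degree m →
          ∀ (n : ℕ) (z : Wreath Γ n), modifiedType z = v →
            b.repr (fhK l * fhK m) v =
              (classSum n l * classSum n m).coeff z)) ∧
    (∃ _ : GradedRing (fhGrade Γ), ∃ J : Ideal (FHRing Γ),
      (∀ a, a ∈ J ↔ a ∈ fhI Γ) ∧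
      J.IsHomogeneous (fhGrade Γ) ∧
      ∃! e : (FHRing Γ ⧸ J) ≃+* FHRing Unit,
        ∀ p : IntPartition,
          e (Ideal.Quotient.mk J (fhK (atId Γ p))) =
            fhK (atId Unit p)) := by
  refine ⟨fun n => ⟨RingHom.ker (restrict Γ n), mem_ker_restrict, fun a ha k => ?_,
    existsUnique_quotient_ker_equiv (restrict Γ n) restrict_grK_atId closure_grK_atId_unit⟩,
    ⟨fhBasis Γ, fhBasis_apply, fun l m v => ⟨fun hv => ?_, fun hv n z hz => ?_⟩⟩, ?_⟩
  · rw [RingHom.mem_ker] at ha ⊢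
    refine grEval_ext fun w => ?_
    -- Every coefficient of a homogeneous component is either zero or a coefficient of `a` itself,
    -- so the kernel contains the components of its elements.
    rw [grEval_restrict, grEval_of, ← grEval_restrict a, ha, map_zero, ite_self]
  · obtain ⟨n, z, rfl⟩ := exists_modifiedType_eq v
    rw [fhBasis_repr]
    show grEval z (grK n l * grK n m) = 0
    exact (grEval_grK_mul l m z).trans (if_neg hv)
  · subst hz
    rw [fhBasis_repr]
    show grEval z (grK n l * grK n m) = _
    exact (grEval_grK_mul l m z).trans (if_pos hv)
  · obtain ⟨inst⟩ := nonempty_gradedRing_fhGrade Γ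
    exact ⟨inst, RingHom.ker (fhRestrict Γ), mem_ker_fhRestrict,
      isHomogeneous_of_mem_iff_fhI mem_ker_fhRestrict,
      existsUnique_quotient_ker_equiv (fhRestrict Γ) fhRestrict_fhK_atId closure_fhK_atId_unit⟩
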